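/- Let $GL_0$ be the group of real $2\times 2$ matrices of positive determinant, let $\widetilde{SL}$ be the universal covering group of $SL(2,\mathbf R)$, let $\Gamma\subset\widetilde{SL}$ be a cocompact lattice (a discrete subgroup with compact quotient), let $H$ be the center of $\Gamma$ and $\bar\Gamma=\Gamma/H$. For a representation $\rho:\Gamma\to GL_0$ let $\lambda(\rho):\Gamma\to PGL_0\cong PSL(2,\mathbf R)$ be its projectivisation. Put $L(\gamma)=\frac12\log\det\rho(\gamma)$ and $t(\gamma)=2\log\big(r(\rho(\gamma))/\sqrt{\det\rho(\gamma)}\big)$, where $r$ denotes the spectral radius. The stable norm of a class $c\in H_1(\bar\Gamma,\mathbf Z)$ is $\|c\|=\lim_{n\to\infty}\inf\{t(\gamma)/n : \gamma\in\Gamma \text{ represents } nc\}$. The stable norm of $L$, as an element of $H^1(\bar\Gamma,\mathbf R)$, is the dual norm $\|L\|=\sup_{c}|L(c)|/\|c\|$ over $c\in H_1(\bar\Gamma,\mathbf Z)$ (with $0/0=0$). (For the representations considered here the limit exists and $L$ is trivial on $H$.) The representation $\rho$ is called hyperbolic if (i) the kernel of $\lambda(\rho)$ is $H$; (ii) for every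 $\gamma\in\Gamma$ such that $\gamma^n\notin H$ for all $n\geq 1$, the matrix $\rho(\gamma)$ has two real eigenvalues, one of absolute value $>1$ and one of absolute value $<1$; (iii) $\|L\|<\frac12$. Let $X_0$ be the space of flags $(x,d)$ of $\mathbf RP^2$, where $x$ is a point of $\mathbf R^2\setminus\{0\}\subset\mathbf RP^2$ and $d$ is a projective line that contains $x$ but not the origin $0$ of $\mathbf R^2$. The group $GL_0$ acts on $X_0$ through its linear action on $\mathbf R^2$, extended to $\mathbf RP^2$. **Theorem.** For every hyperbolic representation $\rho:\Gamma\to GL_0$, the action of the (discrete) group $\rho(\Gamma)$ on $X_0$ is free and proper: no non-trivial element of $\rho(\Gamma)$ fixes a point of $X_0$, and for all compact subsets $K,K'\subset X_0$ only finitely many $g\in\rho(\Gamma)$ satisfy $gK\cap K'\neq\emptyset$. -/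

import Mathlib

open scoped MatrixGroups LinearAlgebra.Projectivization Matrix ENNReal UpperHalfPlane
open UpperHalfPlane Filter

noncomputable section

/-! ### The universal covering group of `SL(2, ℝ)` -/

/-- The universal covering group of `SL(2, ℝ)`, in its standard explicit model: pairs of a matrix
`g` in `SL(2, ℝ)` and a continuous logarithm `φ` on the upper half plane of the nonvanishing
automorphy factor `z ↦ c z + d` of `g`. As the half plane is simply connected, such a `φ` exists
for every `g` and is unique up to `2 π i ℤ`. On the rotation subgroup, `φ (i)` is `i` times the
angle, so the loop that generates the fundamental group of `SL(2, ℝ)` lifts to a path whose end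
points differ by a generator of `2 π i ℤ`. -/
def SLTilde : Type :=
  {p : SL(2, ℝ) × C(ℍ, ℂ) // ∀ z : ℍ, Complex.exp (p.2 z) = denom (p.1 : GL (Fin 2) ℝ) z}

namespace SLTilde

/-- The topology is induced by that of `SL(2, ℝ)` and the compact-open topology. -/
instance : TopologicalSpace SLTilde := instTopologicalSpaceSubtype

theorem ext' {a b : SLTilde} (h : a.1.1 = b.1.1) (h' : ∀ z, a.1.2 z = b.1.2 z) : a = b :=
  Subtype.ext (Prod.ext h (ContinuousMap.ext h'))

theorem denom_mul (g h : SL(2, ℝ)) (z : ℍ) :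
    denom ((g * h : SL(2, ℝ)) : GL (Fin 2) ℝ) z =
      denom (g : GL (Fin 2) ℝ) (h • z : ℍ) * denom (h : GL (Fin 2) ℝ) z := by
  have := denom_cocycle_σ (g : GL (Fin 2) ℝ) (h : GL (Fin 2) ℝ) z
  rw [map_mul, this]
  simp [σ]
  rfl

/-- The map of the half plane given by an element of `SL(2, ℝ)`. -/
def act (g : SL(2, ℝ)) : C(ℍ, ℍ) := ⟨fun z => g • z, continuous_const_smul g⟩

/-- `(g, φ) (h, ψ) = (g h, φ ∘ h + ψ)`. -/
instance : Mul SLTilde where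
  mul a b := ⟨(a.1.1 * b.1.1, a.1.2.comp (act b.1.1) + b.1.2), fun z => by
    rw [denom_mul, ContinuousMap.add_apply, Complex.exp_add, b.2, ContinuousMap.comp_apply, a.2]
    rfl⟩

instance : One SLTilde where
  one := ⟨(1, 0), fun z => by simp [denom]⟩

instance : Inv SLTilde where
  inv a := ⟨(a.1.1⁻¹, -(a.1.2.comp (act a.1.1⁻¹))), fun z => by
    have h := denom_mul a.1.1 a.1.1⁻¹ z
    have h1 : denom (((1 : SL(2, ℝ))) : GL (Fin 2) ℝ) z = 1 := by simp [denom]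
    rw [mul_inv_cancel, h1] at h
    simp only [ContinuousMap.neg_apply, ContinuousMap.comp_apply, Complex.exp_neg, a.2]
    exact inv_eq_of_mul_eq_one_right h.symm⟩

theorem mul_snd (a b : SLTilde) (z : ℍ) : (a * b).1.2 z = a.1.2 (b.1.1 • z) + b.1.2 z := rfl

theorem inv_snd (a : SLTilde) (z : ℍ) : a⁻¹.1.2 z = -a.1.2 (a.1.1⁻¹ • z) := rfl

instance : Group SLTilde :=
  Group.ofLeftAxioms
    (fun a b c => ext' (mul_assoc _ _ _) fun z => by
      rw [mul_snd, mul_snd, mul_snd, mul_snd, add_assoc]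
      change _ = a.1.2 ((b.1.1 * c.1.1) • z) + _
      rw [mul_smul])
    (fun a => ext' (one_mul _) fun z => by rw [mul_snd]; exact zero_add _)
    (fun a => ext' (inv_mul_cancel _) fun z => by
      rw [mul_snd, inv_snd, inv_smul_smul]; exact neg_add_cancel _)

theorem continuous_act : Continuous act :=
  ContinuousMap.continuous_of_continuous_uncurry _
    (continuous_smul : Continuous fun p : SL(2, ℝ) × ℍ => p.1 • p.2)

instance : IsTopologicalGroup SLTilde where
  continuous_mul := by
    refine Continuous.subtype_mk (f := fun p : SLTilde × SLTilde =>
      (p.1.1.1 * p.2.1.1, p.1.1.2.comp (act p.2.1.1) + p.2.1.2)) ?_ _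
    have h1 : Continuous fun p : SLTilde × SLTilde => p.1.1 := continuous_subtype_val.comp continuous_fst
    have h2 : Continuous fun p : SLTilde × SLTilde => p.2.1 := continuous_subtype_val.comp continuous_snd
    refine (h1.fst.mul h2.fst).prodMk (Continuous.add ?_ h2.snd)
    exact h1.snd.compCM (continuous_act.comp h2.fst)
  continuous_inv := by
    refine Continuous.subtype_mk (f := fun p : SLTilde =>
      (p.1.1⁻¹, -(p.1.2.comp (act p.1.1⁻¹)))) ?_ _
    have h1 : Continuous fun p : SLTilde => p.1 := continuous_subtype_val
    exact h1.fst.inv.prodMk (h1.snd.compCM (continuous_act.comp h1.fst.inv)).neg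

end SLTilde

/-! ### The space `X₀` of flags -/

/-- The real projective plane. It is also used for the dual plane: a projective line is given by
its covector `d` of homogeneous coordinates, and consists of the points `x` with `x ⬝ d = 0`, that
is, with `x.orthogonal d`. -/
abbrev RP2 : Type := ℙ ℝ (Fin 3 → ℝ)

/-- The quotient topology of `ℝ³ ∖ 0`. -/
instance RP2.instTopologicalSpace : TopologicalSpace RP2 :=
  TopologicalSpace.coinduced (Projectivization.mk' ℝ) inferInstance

/-- The group of `2 × 2` real matrices of positive determinant. -/
abbrev GL0 : Type := GL(2, ℝ)⁺

/-- `A ↦ diag (A, 1)`. -/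
def blockHom : Matrix (Fin 2) (Fin 2) ℝ →* Matrix (Fin 3) (Fin 3) ℝ where
  toFun A := !![A 0 0, A 0 1, 0; A 1 0, A 1 1, 0; 0, 0, 1]
  map_one' := by ext i j; fin_cases i <;> fin_cases j <;> simp
  map_mul' A B := by
    ext i j; fin_cases i <;> fin_cases j <;> simp [Matrix.mul_apply, Fin.sum_univ_succ]

/-- `GL₀` inside the group of projective transformations that preserve the affine plane. -/
def toGL3 : GL0 →* GL (Fin 3) ℝ := (Units.map blockHom).comp (Subgroup.subtype _)

/-- The inverse of the transposed matrix: the action on covectors. -/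
def theta : GL (Fin 3) ℝ →* GL (Fin 3) ℝ where
  toFun g := ⟨(g⁻¹).1ᵀ, g.1ᵀ, by rw [← Matrix.transpose_mul, ← Units.val_mul]; simp,
    by rw [← Matrix.transpose_mul, ← Units.val_mul]; simp⟩
  map_one' := by
    apply Units.ext
    change ((1 : GL (Fin 3) ℝ)⁻¹).1ᵀ = 1
    simp
  map_mul' g h := by
    apply Units.ext
    change ((g * h)⁻¹).1ᵀ = (g⁻¹).1ᵀ * (h⁻¹).1ᵀ
    rw [← Matrix.transpose_mul, ← Units.val_mul, mul_inv_rev]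

/-- The origin of the affine plane, where `(a, b)` in `ℝ²` is the point `[a : b : 1]`. -/
def origin : RP2 := Projectivization.mk ℝ ![0, 0, 1] (by simp)

/-- The line at infinity `{[a : b : c] | c = 0}`. -/
def lineAtInfinity : RP2 := Projectivization.mk ℝ ![0, 0, 1] (by simp)

/-- The flag variety: the pairs of a point `x` and a line `d` through `x`. -/
def flagVariety : Set (RP2 × RP2) := {f | f.1.orthogonal f.2}

/-- The flags `(x, d)` with `x` in `ℝ² ∖ 0` and `d` not containing `0`. -/
def X0 : Set (RP2 × RP2) :=
  {f | f ∈ flagVariety ∧ (¬ f.1.orthogonal lineAtInfinity ∧ f.1 ≠ origin) ∧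
    ¬ origin.orthogonal f.2}

theorem orthogonal_smul (g : GL (Fin 3) ℝ) (x d : RP2) :
    (g • x).orthogonal (theta g • d) ↔ x.orthogonal d := by
  induction x using Projectivization.ind with | h v hv =>
  induction d using Projectivization.ind with | h w hw =>
  rw [Projectivization.smul_mk, Projectivization.smul_mk, Projectivization.orthogonal_mk,
    Projectivization.orthogonal_mk]
  change (g.1 *ᵥ v) ⬝ᵥ ((g⁻¹).1ᵀ *ᵥ w) = 0 ↔ _
  rw [Matrix.mulVec_transpose, dotProduct_comm, ← Matrix.dotProduct_mulVec, Matrix.mulVec_mulVec,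
    ← Units.val_mul, inv_mul_cancel, Units.val_one, Matrix.one_mulVec, dotProduct_comm]

theorem toGL3_smul_origin (g : GL0) : toGL3 g • origin = origin := by
  rw [origin, Projectivization.smul_mk]
  congr 1
  change blockHom g.1.1 *ᵥ ![0, 0, 1] = _
  ext i; fin_cases i <;> simp [blockHom]

theorem theta_smul_lineAtInfinity (g : GL0) :
    theta (toGL3 g) • lineAtInfinity = lineAtInfinity := by
  rw [lineAtInfinity, Projectivization.smul_mk]
  congr 1
  change (blockHom (g⁻¹).1.1)ᵀ *ᵥ ![0, 0, 1] = _
  ext i; fin_cases i <;>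
    simp [blockHom, Matrix.mulVec, dotProduct, Fin.sum_univ_succ]

theorem smul_mem_X0 (g : GL0) {f : RP2 × RP2} (hf : f ∈ X0) :
    (toGL3 g • f.1, theta (toGL3 g) • f.2) ∈ X0 := by
  obtain ⟨h1, ⟨h2, h3⟩, h4⟩ := hf
  refine ⟨(orthogonal_smul _ _ _).2 h1, ⟨?_, fun h => h3 ?_⟩, ?_⟩
  · rw [← theta_smul_lineAtInfinity g]
    exact fun h => h2 ((orthogonal_smul _ _ _).1 h)
  · exact MulAction.injective (toGL3 g) (h.trans (toGL3_smul_origin g).symm)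
  · rw [← toGL3_smul_origin g]
    exact fun h => h4 ((orthogonal_smul _ _ _).1 h)

/-- The projective action of `GL₀` on `X₀`. -/
instance : MulAction GL0 X0 where
  smul g f := ⟨(toGL3 g • f.1.1, theta (toGL3 g) • f.1.2), smul_mem_X0 g f.2⟩
  one_smul f := Subtype.ext (by
    change (toGL3 1 • f.1.1, theta (toGL3 1) • f.1.2) = f.1
    simp)
  mul_smul g h f := Subtype.ext (by
    change (toGL3 (g * h) • f.1.1, theta (toGL3 (g * h)) • f.1.2) =
      (toGL3 g • toGL3 h • f.1.1, theta (toGL3 g) • theta (toGL3 h) • f.1.2)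
    simp [mul_smul])

/-! ### Hyperbolic representations -/

section Hyperbolic

variable {G : Type*} [Group G]

/-- The projectivised linear part, with values in `GL₀` modulo its center (the homotheties),
that is, in `PGL₀ = PSL(2, ℝ)`. -/
def projLinearPart (ρ : G →* GL0) : G →* GL0 ⧸ Subgroup.center GL0 :=
  (QuotientGroup.mk' (Subgroup.center GL0)).comp ρ

/-- The kernel of the projectivised linear part is the center `H`, and every element without
nontrivial power in `H` is mapped to a linear map of saddle type. -/
structure IsHyperbolicRep (ρ : G →* GL0) : Prop where
  ker_eq : (projLinearPart ρ).ker = Subgroup.center G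
  saddle : ∀ γ : G, (∀ n : ℕ, 0 < n → γ ^ n ∉ Subgroup.center G) →
    ∃ a b : ℝ, 1 < |a| ∧ |b| < 1 ∧
      Module.End.HasEigenvalue (Matrix.toLin' (ρ γ).1.1) a ∧
      Module.End.HasEigenvalue (Matrix.toLin' (ρ γ).1.1) b

/-- The logarithm `L` of the homothety factor of `ρ γ`, the square root of its determinant. -/
def logFactor (ρ : G →* GL0) (γ : G) : ℝ :=
  Real.log √(ρ γ).1.1.det

/-- Twice the logarithm of the spectral radius of the unimodular part of `ρ γ`. If this part is
hyperbolic, it is its translation length in the hyperbolic plane, and so the length of the closed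
geodesic of `γ` in the quotient; otherwise it is zero. -/
def geodesicLength (ρ : G →* GL0) (γ : G) : ℝ :=
  2 * Real.log ((spectralRadius ℂ
    ((ρ γ).1.1.map (algebraMap ℝ ℂ))).toReal /
      √(ρ γ).1.1.det)

/-- The first integral homology of `G` modulo its center. -/
abbrev HomologyModCenter (G : Type*) [Group G] : Type _ :=
  Additive (Abelianization (G ⧸ Subgroup.center G))

/-- The homology class of an element. -/
def homologyClass (γ : G) : HomologyModCenter G :=
  Additive.ofMul (Abelianization.of (γ : G ⧸ Subgroup.center G))

/-- The stable norm of an integral homology class `c`: the limit in `n` of the infimum of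
`geodesicLength ρ γ / n` over all `γ` that represent `n c`. (For a cocompact Fuchsian
`projLinearPart ρ` the limit exists, so that it is the lower limit.) -/
def stableNorm (ρ : G →* GL0) (c : HomologyModCenter G) : ℝ :=
  liminf (fun n : ℕ => sInf {s : ℝ | ∃ γ : G, homologyClass γ = n • c ∧
    s = geodesicLength ρ γ / n}) atTop

/-- The stable norm of the class of `logFactor ρ` in the first real cohomology: the dual norm,
i.e. the least `C` with `|L c| ≤ C ‖c‖` for all homology classes `c`. By homogeneity and density it
is enough to take the supremum over integral classes; in `ℝ≥0∞`, `0 / 0 = 0` and `a / 0 = ∞` for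
`a ≠ 0`. -/
def dualStableNorm (ρ : G →* GL0) : ℝ≥0∞ :=
  ⨆ γ : G, ENNReal.ofReal |logFactor ρ γ| / ENNReal.ofReal (stableNorm ρ (homologyClass γ))

end Hyperbolic

end

/-! Properness has a quantitative half and a discreteness half. Normalise a flag as a vector `x` and
a covector `m` with `m x = 1`. If `A = ρ γ` moves a flag of a compact set into a compact set, then
`A` is a bounded rank-one matrix plus `det A` times another one, so its entries are `O(1 + δ ^ 2)`
with `δ = √(det A)` (`abs_apply_le_of_pairing`). Hence `t(γ) ≤ 2 |log δ| + O(1)`, while `L(γ) = log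
δ` and `|L(γ)| ≤ ‖L‖ t(γ)`. As `‖L‖ < 1/2`, this bounds `|log δ|` (`bound_of_abs_log_le`), and `A`
and `A⁻¹` lie in a fixed compact set.

It remains to see that `ρ(Γ)` is discrete (`exists_nhds_eq_one`). Elements of `Γ` with a central
power have images of bounded order, since `Γ` is cocompact and `ρ` sends the center to `±1`; all
other images are saddles (`exists_pow_eq_one_or_isSaddle`). So unimodular images other than `1` have
no trace just below or equal to `2`. If the image were not discrete, a Jørgensen iteration
(`commute_of_commDefect_lt`) would make a saddle close to `1` commute with any given saddle and with
a conjugate of it. Each saddle would then be conjugate only to itself and to a multiple of its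
inverse. In `Γ` this confines a conjugacy class to a bounded set, against cocompactness
(`exists_lt_abs_conj`).

Freeness: an element that fixes a flag has eigenvalue `1`, which no saddle has, and a matrix of
finite order and positive determinant with eigenvalue `1` is trivial. -/

/-! ### The covering map onto `SL(2, ℝ)` -/

namespace SLTilde

/-- The covering map onto `SL(2, ℝ)`. -/
def proj : SLTilde →* SL(2, ℝ) where
  toFun p := p.1.1
  map_one' := rfl
  map_mul' _ _ := rfl

theorem continuous_proj : Continuous proj := continuous_subtype_val.fst

theorem denom_apply (g : SL(2, ℝ)) (z : ℍ) :
    denom (g : GL (Fin 2) ℝ) z = (g.1 1 0 : ℂ) * z + g.1 1 1 := rfl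

theorem denom_mem_slitPlane {g : SL(2, ℝ)} (h : g.1 1 0 ≠ 0 ∨ 0 < g.1 1 1) (z : ℍ) :
    denom (g : GL (Fin 2) ℝ) z ∈ Complex.slitPlane := by
  rw [denom_apply, Complex.mem_slitPlane_iff]
  by_cases hc : g.1 1 0 = 0
  · left
    simpa [hc] using h
  · right
    simpa [hc] using z.im_ne_zero

theorem continuous_denom (g : SL(2, ℝ)) : Continuous fun z : ℍ => denom (g : GL (Fin 2) ℝ) z := by
  simp only [denom_apply]
  fun_prop

/-- The lift of a matrix given by the principal branch of the logarithm. -/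
noncomputable def logLift (g : SL(2, ℝ)) (h : g.1 1 0 ≠ 0 ∨ 0 < g.1 1 1) : SLTilde :=
  ⟨(g, ⟨fun z => Complex.log (denom (g : GL (Fin 2) ℝ) z),
    (continuous_denom g).clog (denom_mem_slitPlane h)⟩),
    fun z => Complex.exp_log (Complex.slitPlane_ne_zero (denom_mem_slitPlane h z))⟩

theorem proj_logLift (g : SL(2, ℝ)) (h : g.1 1 0 ≠ 0 ∨ 0 < g.1 1 1) : proj (logLift g h) = g := rfl

theorem logLift_one (h) : logLift 1 h = 1 :=
  ext' rfl fun z => by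
    change Complex.log _ = 0
    rw [denom_apply]
    simp

/-- A neighbourhood of `1` on which the principal lift is continuous. -/
def logDomain : Set SL(2, ℝ) := {g | 0 < g.1 1 1}

theorem continuous_SL_apply (i j : Fin 2) : Continuous fun g : SL(2, ℝ) => g.1 i j :=
  Continuous.matrix_elem continuous_subtype_val i j

theorem continuous_logDomain_apply (i j : Fin 2) : Continuous fun g : logDomain => g.1.1 i j :=
  (continuous_SL_apply i j).comp continuous_subtype_val

theorem continuous_logLift : Continuous fun g : logDomain => logLift g.1 (Or.inr g.2) := by
  refine Continuous.subtype_mk (continuous_subtype_val.prodMk ?_) _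
  refine ContinuousMap.continuous_of_continuous_uncurry _ ?_
  refine Continuous.clog ?_ fun p => denom_mem_slitPlane (Or.inr p.1.2) p.2
  simp only [denom_apply]
  have h1 := (continuous_logDomain_apply 1 0).comp (continuous_fst (Y := ℍ))
  have h2 := (continuous_logDomain_apply 1 1).comp (continuous_fst (Y := ℍ))
  have h3 := UpperHalfPlane.continuous_coe.comp (continuous_snd (X := logDomain))
  exact ((Complex.continuous_ofReal.comp h1).mul h3).add (Complex.continuous_ofReal.comp h2)

/-- The lift of `-1` with angle `π`. -/
noncomputable def negOneLift : SLTilde :=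
  ⟨(-1, ⟨fun _ => Real.pi * Complex.I, continuous_const⟩), fun z => by
    rw [denom_apply]
    simp⟩

theorem proj_surjective : Function.Surjective proj := by
  intro g
  by_cases h : g.1 1 0 ≠ 0 ∨ 0 < g.1 1 1
  · exact ⟨_, proj_logLift g h⟩
  -- Only `c = 0`, `d < 0` is left, where `-g` is in the domain of the principal branch.
  · push Not at h
    have hd : g.1 1 1 ≠ 0 := fun h1 => by
      have := g.2
      rw [Matrix.det_fin_two, h.1, h1] at this
      simp at this
    have h' : (-g).1 1 0 ≠ 0 ∨ 0 < (-g).1 1 1 := by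
      right
      have := lt_of_le_of_ne h.2 hd
      simpa using this
    refine ⟨negOneLift * logLift (-g) h', ?_⟩
    rw [map_mul, proj_logLift]
    change -1 * -g = g
    simp

/-- Such a `p` acts trivially on `ℍ` and its logarithm takes values in a coset of `2 π i ℤ`, so it
is constant by connectedness; both products add this constant to the logarithm of `q`. -/
theorem commute_of_proj {p : SLTilde} (hp : proj p = 1 ∨ proj p = -1) (q : SLTilde) :
    p * q = q * p := by
  have hc : ∀ g : SL(2, ℝ), proj p * g = g * proj p := by
    rcases hp with h | h <;> intro g <;> simp [h]
  have hs : ∀ z : ℍ, p.1.1 • z = z := by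
    intro z
    change proj p • z = z
    rcases hp with h | h
    · simp [h]
    · rw [h]
      ext
      rw [UpperHalfPlane.specialLinearGroup_apply]
      simp
  have hexp : ∃ a : ℂ, ∀ z, Complex.exp (p.1.2 z) = a := by
    rcases hp with h | h
    · refine ⟨1, fun z => ?_⟩
      rw [p.2]
      change denom (proj p : GL (Fin 2) ℝ) z = _
      rw [h, denom_apply]; simp
    · refine ⟨-1, fun z => ?_⟩
      rw [p.2]
      change denom (proj p : GL (Fin 2) ℝ) z = _
      rw [h, denom_apply]; simp
  obtain ⟨a, ha⟩ := hexp
  have hconst : ∀ z w, p.1.2 z = p.1.2 w := by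
    intro z w
    have hcont : Continuous fun z => (p.1.2 z - p.1.2 w) / (2 * Real.pi * Complex.I) := by fun_prop
    have hint : ∀ z, ∃ n : ℤ, (p.1.2 z - p.1.2 w) / (2 * Real.pi * Complex.I) = n := by
      intro z
      obtain ⟨n, hn⟩ := Complex.exp_eq_exp_iff_exists_int.1 ((ha z).trans (ha w).symm)
      refine ⟨n, ?_⟩
      rw [hn]
      field_simp [Complex.two_pi_I_ne_zero]
      ring
    choose n hn using hint
    have hn' : Continuous n := by
      rw [Int.isClosedEmbedding_coe_real.isInducing.continuous_iff]
      have : ((fun m : ℤ => (m : ℝ)) ∘ n) =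
          fun z => ((p.1.2 z - p.1.2 w) / (2 * Real.pi * Complex.I)).re := by
        ext z; rw [hn z]; simp
      rw [this]
      exact Complex.continuous_re.comp hcont
    have h1 := PreconnectedSpace.constant inferInstance hn' (x := z) (y := w)
    have h2 := hn z
    rw [h1, ← hn w, sub_self, zero_div, div_eq_zero_iff] at h2
    rcases h2 with h2 | h2
    · exact sub_eq_zero.1 h2
    · exact absurd h2 Complex.two_pi_I_ne_zero
  refine ext' (hc _) fun z => ?_
  rw [mul_snd, mul_snd, hs, hconst _ z, add_comm]

end SLTilde

/-! ### Real `2 × 2` matrices of finite order -/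

theorem Matrix.sq_eq_trace_smul_sub {R : Type*} [CommRing R] (B : Matrix (Fin 2) (Fin 2) R) :
    B * B = B.trace • B - B.det • 1 := by
  ext i j
  fin_cases i <;> fin_cases j <;>
    simp [Matrix.mul_apply, Fin.sum_univ_two, Matrix.trace_fin_two, Matrix.det_fin_two] <;> ring

/-- `μ` is a complex eigenvalue; the determinant makes `μ⁻¹` the other one. -/
theorem Matrix.exists_rootOfUnity_trace {B : Matrix (Fin 2) (Fin 2) ℝ} (hdet : B.det = 1) {m : ℕ}
    (hm : B ^ m = 1) : ∃ μ : ℂ, μ ^ m = 1 ∧ (B.trace : ℂ) = μ + μ⁻¹ := by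
  set C : Matrix (Fin 2) (Fin 2) ℂ := B.map Complex.ofRealHom with hC
  have hCm : C ^ m = 1 := by
    rw [hC, ← Matrix.map_pow, hm]
    simp
  obtain ⟨μ, hμ⟩ := IsAlgClosed.exists_root C.charpoly (by
    rw [Matrix.charpoly_degree_eq_dim]; simp)
  have hs : μ ∈ spectrum ℂ C := Matrix.mem_spectrum_iff_isRoot_charpoly.2 hμ
  have h1 : μ ^ m ∈ spectrum ℂ (C ^ m) := spectrum.pow_mem_pow C m hs
  rw [hCm, spectrum.one_eq] at h1
  have htr : C.trace = (B.trace : ℂ) := by simp [hC, Matrix.trace_fin_two]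
  have hd : C.det = 1 := by
    have := congrArg (fun x : ℝ => (x : ℂ)) hdet
    simpa [hC, Matrix.det_fin_two] using this
  rw [Polynomial.IsRoot, Matrix.charpoly_fin_two, htr, hd] at hμ
  simp at hμ
  have h0 : μ ≠ 0 := by rintro rfl; simp at hμ
  refine ⟨μ, by simpa using h1, ?_⟩
  field_simp
  linear_combination -hμ

/-- By Cayley–Hamilton `(B - 1) ^ 2 = 0`, so the powers of `B` grow linearly unless `B = 1`. -/
theorem Matrix.eq_one_of_trace_eq_two {B : Matrix (Fin 2) (Fin 2) ℝ} (hdet : B.det = 1) {m : ℕ}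
    (hm0 : 0 < m) (hm : B ^ m = 1) (htr : B.trace = 2) : B = 1 := by
  have h := B.sq_eq_trace_smul_sub
  rw [hdet, htr] at h
  have hp : ∀ n : ℕ, B ^ n = 1 + (n : ℝ) • (B - 1) := by
    intro n
    induction n with
    | zero => simp
    | succ n ih =>
      rw [pow_succ, ih, add_mul, smul_mul_assoc, sub_mul, h]
      push_cast
      rw [one_smul, one_mul]
      module
  rw [hp m, add_eq_left, smul_eq_zero, sub_eq_zero] at hm
  rcases hm with hm | hm
  · exact absurd hm (by positivity)
  · exact hm

theorem Matrix.abs_trace_lt_two {B : Matrix (Fin 2) (Fin 2) ℝ} (hdet : B.det = 1) {m : ℕ}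
    (hm0 : 0 < m) (hm : B ^ m = 1) (h1 : B ≠ 1) (h2 : B ≠ -1) : |B.trace| < 2 := by
  obtain ⟨μ, hμ, htr⟩ := Matrix.exists_rootOfUnity_trace hdet hm
  have hn : ‖μ‖ = 1 := Complex.norm_eq_one_of_pow_eq_one hμ hm0.ne'
  have hle : |B.trace| ≤ 2 := by
    have : ‖(B.trace : ℂ)‖ ≤ 2 := by
      rw [htr]
      refine (norm_add_le _ _).trans ?_
      rw [norm_inv, hn]; norm_num
    simpa using this
  refine lt_of_le_of_ne hle fun h => ?_
  rcases eq_or_eq_neg_of_abs_eq h with h | h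
  · exact h1 (Matrix.eq_one_of_trace_eq_two hdet hm0 hm h)
  · refine h2 ?_
    rw [← neg_eq_iff_eq_neg]
    refine Matrix.eq_one_of_trace_eq_two (m := m * 2) ?_ (by positivity) ?_ ?_
    · simpa [Matrix.det_neg] using hdet
    · rw [mul_comm, pow_mul, neg_sq, ← pow_mul, mul_comm, pow_mul, hm, one_pow]
    · rw [Matrix.trace_neg, h, neg_neg]

/-- The traces of unimodular matrices of a given finite order do not accumulate at `2`. -/
theorem Matrix.exists_trace_gap {m : ℕ} (hm0 : 0 < m) : ∃ ε > 0, ∀ B : Matrix (Fin 2) (Fin 2) ℝ,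
    B.det = 1 → B ^ m = 1 → |B.trace - 2| < ε → B = 1 := by
  -- A finite set that contains all possible traces.
  set S : Set ℝ := (fun μ : ℂ => (μ + μ⁻¹).re) '' {μ | μ ^ m = 1} with hS
  have hfin : S.Finite := by
    refine Set.Finite.image _ ?_
    refine (Polynomial.nthRoots m (1 : ℂ)).toFinset.finite_toSet.subset fun μ hμ => ?_
    simpa [Polynomial.mem_nthRoots hm0] using hμ
  have hopen : (S \ {2})ᶜ ∈ nhds (2 : ℝ) :=
    (hfin.subset Set.sdiff_subset).isClosed.isOpen_compl.mem_nhds (by simp)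
  obtain ⟨ε, hε, h⟩ := Metric.mem_nhds_iff.1 hopen
  refine ⟨ε, hε, fun B hdet hm htr => ?_⟩
  obtain ⟨μ, hμ, hμt⟩ := Matrix.exists_rootOfUnity_trace hdet hm
  refine Matrix.eq_one_of_trace_eq_two hdet hm0 hm ?_
  by_contra hne
  refine h (show B.trace ∈ Metric.ball 2 ε from htr) ⟨⟨μ, hμ, ?_⟩, hne⟩
  simp only [← hμt, Complex.ofReal_re]

/-! ### Commutation of `2 × 2` matrices -/

theorem Matrix.exists_eq_smul_one_iff {x : Matrix (Fin 2) (Fin 2) ℝ} :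
    (∃ c : ℝ, x = c • 1) ↔ x 0 1 = 0 ∧ x 1 0 = 0 ∧ x 0 0 = x 1 1 := by
  constructor
  · rintro ⟨c, rfl⟩
    simp
  · rintro ⟨h1, h2, h3⟩
    refine ⟨x 1 1, ?_⟩
    ext i j
    fin_cases i <;> fin_cases j <;> simp [h1, h2, h3]

/-- The three equations say that the trace-free parts, seen as vectors in `ℝ³`, have vanishing cross
product. -/
theorem Matrix.commute_fin_two_iff {A B : Matrix (Fin 2) (Fin 2) ℝ} :
    Commute A B ↔ A 0 1 * B 1 0 = B 0 1 * A 1 0 ∧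
      A 0 1 * (B 0 0 - B 1 1) = B 0 1 * (A 0 0 - A 1 1) ∧
      A 1 0 * (B 0 0 - B 1 1) = B 1 0 * (A 0 0 - A 1 1) := by
  rw [commute_iff_eq, ← Matrix.ext_iff]
  simp only [Fin.forall_fin_two, Matrix.mul_apply, Fin.sum_univ_two]
  constructor
  · rintro ⟨⟨h1, h2⟩, h3, h4⟩
    refine ⟨by linarith, by linarith, by linarith⟩
  · rintro ⟨h1, h2, h3⟩
    refine ⟨⟨by linarith, by linarith⟩, by linarith, by linarith⟩

/-- The centralizer of a nonscalar `2 × 2` matrix is commutative. -/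
theorem Matrix.commute_of_commute_of_ne_smul_one {x A B : Matrix (Fin 2) (Fin 2) ℝ}
    (hx : ¬ ∃ c : ℝ, x = c • 1) (hA : Commute A x) (hB : Commute B x) : Commute A B := by
  rw [Matrix.exists_eq_smul_one_iff] at hx
  rw [Matrix.commute_fin_two_iff] at *
  obtain ⟨a1, a2, a3⟩ := hA
  obtain ⟨b1, b2, b3⟩ := hB
  have key : ∀ p : ℝ, p ≠ 0 → ∀ q r : ℝ, p * q = p * r → q = r :=
    fun p hp q r h => mul_left_cancel₀ hp h
  by_cases h1 : x 0 1 = 0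
  · by_cases h2 : x 1 0 = 0
    · have h3 : x 0 0 - x 1 1 ≠ 0 := fun h => hx ⟨h1, h2, sub_eq_zero.1 h⟩
      refine ⟨key _ h3 _ _ ?_, key _ h3 _ _ ?_, key _ h3 _ _ ?_⟩
      · linear_combination B 1 0 * a2 - A 1 0 * b2 -
          (A 1 0 * (B 0 0 - B 1 1) - B 1 0 * (A 0 0 - A 1 1)) * h1
      · linear_combination (B 0 0 - B 1 1) * a2 - (A 0 0 - A 1 1) * b2
      · linear_combination (B 0 0 - B 1 1) * a3 - (A 0 0 - A 1 1) * b3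
    · refine ⟨key _ h2 _ _ ?_, key _ h2 _ _ ?_, key _ h2 _ _ ?_⟩
      · linear_combination B 1 0 * a1 - A 1 0 * b1
      · linear_combination (B 0 0 - B 1 1) * a1 - (A 0 0 - A 1 1) * b1 +
          (A 1 0 * (B 0 0 - B 1 1) - B 1 0 * (A 0 0 - A 1 1)) * h1
      · linear_combination B 1 0 * a3 - A 1 0 * b3
  · have g1 := key _ h1 _ _ (by linear_combination B 0 1 * a1 - A 0 1 * b1 :
      x 0 1 * (A 0 1 * B 1 0) = x 0 1 * (B 0 1 * A 1 0))
    refine ⟨g1, key _ h1 _ _ ?_, key _ h1 _ _ ?_⟩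
    · linear_combination B 0 1 * a2 - A 0 1 * b2
    · linear_combination B 1 0 * a2 - A 1 0 * b2 - (x 0 0 - x 1 1) * g1

/-! ### Entry bounds, elliptic matrices and discrete subgroups -/

theorem Matrix.abs_apply_le_sum (A : Matrix (Fin 2) (Fin 2) ℝ) (i j : Fin 2) :
    |A i j| ≤ ∑ i, ∑ j, |A i j| :=
  (Finset.single_le_sum (f := fun j => |A i j|) (fun _ _ => abs_nonneg _) (Finset.mem_univ j)).trans
    (Finset.single_le_sum (f := fun i => ∑ j, |A i j|)
      (fun _ _ => Finset.sum_nonneg fun _ _ => abs_nonneg _) (Finset.mem_univ i))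

theorem Matrix.abs_mul_apply_le {A B : Matrix (Fin 2) (Fin 2) ℝ} {a b : ℝ}
    (hA : ∀ i j, |A i j| ≤ a) (hB : ∀ i j, |B i j| ≤ b) (i j : Fin 2) :
    |(A * B) i j| ≤ 2 * (a * b) := by
  have ha : 0 ≤ a := (abs_nonneg _).trans (hA 0 0)
  rw [Matrix.mul_apply, Fin.sum_univ_two]
  refine (abs_add_le _ _).trans ?_
  rw [abs_mul, abs_mul, two_mul]
  exact add_le_add (mul_le_mul (hA _ _) (hB _ _) (abs_nonneg _) ha)
    (mul_le_mul (hA _ _) (hB _ _) (abs_nonneg _) ha)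

theorem Matrix.SpecialLinearGroup.abs_inv_apply_le {g : SL(2, ℝ)} {a : ℝ}
    (hg : ∀ i j, |g.1 i j| ≤ a) (i j : Fin 2) : |(g⁻¹).1 i j| ≤ a := by
  rw [Matrix.SpecialLinearGroup.SL2_inv_expl]
  fin_cases i <;> fin_cases j <;> simp [hg]

theorem Matrix.SpecialLinearGroup.eq_one_or_eq_neg_one {g : SL(2, ℝ)} (h : ∃ c : ℝ, g.1 = c • 1) :
    g = 1 ∨ g = -1 := by
  obtain ⟨c, hc⟩ := h
  have h1 : c * c = 1 := by
    have := g.2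
    rw [hc] at this
    rwa [Matrix.det_smul, Matrix.det_one, mul_one, Fintype.card_fin, sq] at this
  rcases mul_self_eq_one_iff.1 h1 with rfl | rfl
  · left; apply Subtype.ext; simp [hc]
  · right; apply Subtype.ext; simp [hc]

/-- An elliptic `g` is conjugate to a rotation, whose entries are sines and cosines. -/
theorem Matrix.SpecialLinearGroup.exists_conj_abs_le_one {g : SL(2, ℝ)} (hg : |g.1.trace| < 2) :
    ∃ k : SL(2, ℝ), ∀ i j, |(k⁻¹ * g * k).1 i j| ≤ 1 := by
  have hdet := g.2
  rw [Matrix.det_fin_two] at hdet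
  rw [Matrix.trace_fin_two] at hg
  obtain ⟨hg1, hg2⟩ := abs_lt.1 hg
  set a := g.1 0 0 with ha
  set b := g.1 0 1 with hb
  set c := g.1 1 0 with hc
  set d := g.1 1 1 with hd
  have hpos : 0 < 4 - (a + d) ^ 2 := by nlinarith
  have hc0 : c ≠ 0 := by
    intro h
    rw [h] at hdet
    nlinarith [sq_nonneg (a - d)]
  set s := √(4 - (a + d) ^ 2) with hs
  have hs0 : 0 < s := Real.sqrt_pos.2 hpos
  have hss : s ^ 2 = 4 - (a + d) ^ 2 := Real.sq_sqrt hpos.le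
  -- `x + i y` is the fixed point of `g` in the half plane; `k` below maps `i` to it.
  set y := s / (2 * |c|) with hy
  set x := (a - d) / (2 * c) with hx
  have hy0 : 0 < y := by positivity
  set r := √y with hr
  have hr0 : r ≠ 0 := (Real.sqrt_pos.2 hy0).ne'
  have hrr : r * r = y := Real.mul_self_sqrt hy0.le
  have hxc : x * c = (a - d) / 2 := by rw [hx]; field_simp
  have hyc : (c * y) ^ 2 = s ^ 2 / 4 := by
    rw [mul_pow, hy, div_pow, mul_pow, sq_abs]; field_simp; norm_num
  have hgm : g.1 = !![a, b; c, d] := by ext i j; fin_cases i <;> fin_cases j <;> rfl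
  clear_value a b c d s x y r
  let k : SL(2, ℝ) := ⟨!![r, x / r; 0, 1 / r], by rw [Matrix.det_fin_two_of]; field_simp; ring⟩
  refine ⟨k, ?_⟩
  have hk : (k⁻¹ * g * k).1 = !![(a + d) / 2, -(c * y); c * y, (a + d) / 2] := by
    have hk' : k⁻¹.1 = !![1 / r, -(x / r); 0, r] := by
      rw [Matrix.SpecialLinearGroup.SL2_inv_expl]
      ext i j
      fin_cases i <;> fin_cases j <;> simp [k]
    have e3 : a * x + b - x * (c * x + d) = -(c * y ^ 2) := by
      apply mul_left_cancel₀ hc0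
      have : c * (a * x + b - x * (c * x + d)) =
          a * (x * c) + b * c - (x * c) * (x * c) - d * (x * c) := by
        ring
      rw [this, hxc]
      linear_combination hyc + hss / 4 - hdet
    rw [Matrix.SpecialLinearGroup.coe_mul, Matrix.SpecialLinearGroup.coe_mul, hk', hgm,
      show k.1 = !![r, x / r; 0, 1 / r] from rfl, Matrix.mul_fin_two, Matrix.mul_fin_two]
    have f1 : (1 / r * a + -(x / r) * c) * r + (1 / r * b + -(x / r) * d) * 0 = (a + d) / 2 := by
      field_simp
      linear_combination -2 * r * hxc
    have f2 : (1 / r * a + -(x / r) * c) * (x / r) + (1 / r * b + -(x / r) * d) * (1 / r) =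
        -(c * y) := by
      field_simp
      linear_combination e3 + c * y * hrr
    have f3 : (0 * a + r * c) * r + (0 * b + r * d) * 0 = c * y := by
      linear_combination c * hrr
    have f4 : (0 * a + r * c) * (x / r) + (0 * b + r * d) * (1 / r) = (a + d) / 2 := by
      field_simp
      linear_combination 2 * r * hxc
    rw [f1, f2, f3, f4]
  rw [hk]
  have h1 : |(a + d) / 2| ≤ 1 := by rw [abs_le]; constructor <;> linarith
  have h2 : |c * y| ≤ 1 := by
    rw [← sq_le_one_iff_abs_le_one, hyc, hss]; nlinarith [sq_nonneg (a + d)]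
  have h3 : |-(c * y)| ≤ 1 := by rwa [abs_neg]
  intro i j
  fin_cases i <;> fin_cases j <;> assumption

open scoped Topology in
/-- A subgroup that meets a neighbourhood of `1` trivially has finite intersection with every
compact set. -/
theorem Subgroup.finite_inter_of_isCompact {G : Type*} [Group G] [TopologicalSpace G]
    [IsTopologicalGroup G] [T2Space G] {H : Subgroup G} {V : Set G} (hV : V ∈ 𝓝 1)
    (hHV : ∀ h ∈ H, h ∈ V → h = 1) {K : Set G} (hK : IsCompact K) : ((H : Set G) ∩ K).Finite := by
  have : DiscreteTopology H := by
    apply discreteTopology_of_isOpen_singleton_one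
    rw [isOpen_singleton_iff_nhds_eq_pure, nhds_subtype_eq_comap]
    refine le_antisymm ?_ (pure_le_nhds _ |>.trans_eq (nhds_subtype_eq_comap ..))
    rw [le_pure_iff]
    exact ⟨V, hV, fun h hh => Subtype.ext (hHV h.1 h.2 hh)⟩
  have hcl : IsClosed (H : Set G) := Subgroup.isClosed_of_discrete
  have hd : IsDiscrete (H : Set G) := ⟨this⟩
  exact (hK.inter_left hcl).finite (hd.mono Set.inter_subset_left)

/-- A finite set of elements of a monoid has a common period for its elements of finite order. -/
theorem Set.Finite.exists_pow_eq_one {G : Type*} [Monoid G] {E : Set G} (hE : E.Finite) :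
    ∃ N > 0, ∀ e ∈ E, IsOfFinOrder e → e ^ N = 1 := by
  classical
  refine ⟨∏ e ∈ hE.toFinset, if orderOf e = 0 then 1 else orderOf e,
    Finset.prod_pos fun e _ => ?_, fun e he hfin => ?_⟩
  · split_ifs <;> omega
  · rw [← orderOf_dvd_iff_pow_eq_one]
    have := Finset.dvd_prod_of_mem (fun e => if orderOf e = 0 then 1 else orderOf e)
      (hE.mem_toFinset.2 he)
    rwa [if_neg hfin.orderOf_pos.ne'] at this

theorem Matrix.isCompact_setOf_abs_apply_le (C : ℝ) :
    IsCompact {A : Matrix (Fin 2) (Fin 2) ℝ | ∀ i j, |A i j| ≤ C} := by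
  have := isCompact_univ_pi fun _ : Fin 2 => isCompact_univ_pi fun _ : Fin 2 =>
    isCompact_Icc (a := -C) (b := C)
  refine (congrArg IsCompact (Set.ext fun A => ?_)).mp this
  exact ⟨fun h i j => abs_le.2 (h i trivial j trivial), fun h i _ j _ => abs_le.1 (h i j)⟩

/-! ### Cocompact discrete subgroups of the universal cover -/

namespace SLTilde

variable (Γ : Subgroup SLTilde)

/-- The images of the open sets of bounded entries exhaust the compact quotient, so one of them is
everything. -/
theorem exists_bounded_representatives [CompactSpace (SLTilde ⧸ Γ)] :
    ∃ R : ℝ, ∀ g : SL(2, ℝ), ∃ γ ∈ Γ, ∀ i j, |(g * proj γ).1 i j| ≤ R := by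
  let U : ℕ → Set SLTilde := fun n => {p | ∀ i j, |(proj p).1 i j| < n}
  have hU : ∀ n, IsOpen (U n) := fun n => by
    have : U n = ⋂ i, ⋂ j, {p | |(proj p).1 i j| < n} := by ext; simp [U]
    rw [this]
    exact isOpen_iInter_of_finite fun i => isOpen_iInter_of_finite fun j =>
      isOpen_lt ((continuous_SL_apply i j).comp continuous_proj).abs continuous_const
  obtain ⟨n, hn⟩ := (isCompact_univ (X := SLTilde ⧸ Γ)).elim_directed_cover
    (fun n => (QuotientGroup.mk : SLTilde → SLTilde ⧸ Γ) '' U n)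
    (fun n => QuotientGroup.isOpenMap_coe _ (hU n))
    (fun q _ => by
      obtain ⟨p, rfl⟩ := QuotientGroup.mk_surjective q
      obtain ⟨n, hn⟩ := exists_nat_gt (∑ i, ∑ j, |(proj p).1 i j|)
      refine Set.mem_iUnion.2 ⟨n, p, fun i j => lt_of_le_of_lt ((proj p).1.abs_apply_le_sum i j) hn, rfl⟩)
    (directed_of_isDirected_le fun m n hmn => Set.image_mono fun p hp i j =>
      (hp i j).trans_le (by exact_mod_cast hmn))
  refine ⟨n, fun g => ?_⟩
  obtain ⟨p, rfl⟩ := proj_surjective g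
  obtain ⟨q, hq, hqp⟩ := hn (Set.mem_univ (p : SLTilde ⧸ Γ))
  refine ⟨p⁻¹ * q, QuotientGroup.eq.1 hqp.symm, fun i j => ?_⟩
  rw [← map_mul, mul_inv_cancel_left]
  exact (hq i j).le

variable {Γ}

/-- The orbit of a nonscalar matrix under conjugation by a cocompact group is unbounded. -/
theorem exists_lt_abs_conj [CompactSpace (SLTilde ⧸ Γ)] {x : Matrix (Fin 2) (Fin 2) ℝ}
    (hx : ¬ ∃ c : ℝ, x = c • 1) (C : ℝ) :
    ∃ γ ∈ Γ, ∃ i j, C < |((proj γ).1 * x * (proj γ)⁻¹.1) i j| := by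
  by_contra! hC
  obtain ⟨R, hR⟩ := exists_bounded_representatives Γ
  -- A bound on the `Γ`-conjugates spreads to all of `SL(2, ℝ)`: write `g x g⁻¹` as the conjugate of
  -- `γ⁻¹ x γ` by the bounded matrix `g γ`.
  have hb : ∀ g : SL(2, ℝ), |(g.1 * x * g⁻¹.1) 0 1| ≤ 2 * (2 * (R * C) * R) ∧
      |(g.1 * x * g⁻¹.1) 1 0| ≤ 2 * (2 * (R * C) * R) := by
    intro g
    obtain ⟨γ, hγ, hg⟩ := hR g
    have h1 := fun i j => hC γ⁻¹ (inv_mem hγ) i j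
    rw [map_inv, inv_inv] at h1
    have h2 := Matrix.abs_mul_apply_le (Matrix.abs_mul_apply_le hg h1)
      (Matrix.SpecialLinearGroup.abs_inv_apply_le hg)
    have h3 : (g * proj γ).1 * ((proj γ)⁻¹.1 * x * (proj γ).1) * (g * proj γ)⁻¹.1 =
        g.1 * x * g⁻¹.1 := by
      have e1 : (g * proj γ).1 * (proj γ)⁻¹.1 = g.1 := by
        rw [← Matrix.SpecialLinearGroup.coe_mul, mul_inv_cancel_right]
      have e2 : (proj γ).1 * (g * proj γ)⁻¹.1 = g⁻¹.1 := by
        rw [← Matrix.SpecialLinearGroup.coe_mul, mul_inv_rev, mul_inv_cancel_left]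
      rw [← e2, ← mul_assoc, ← mul_assoc, e1]
      simp only [mul_assoc]
    rw [h3] at h2
    exact ⟨h2 0 1, h2 1 0⟩
  set K := 2 * (2 * (R * C) * R)
  have hK : 0 ≤ K := (abs_nonneg _).trans (hb 1).1
  -- Diagonal conjugation stretches the off-diagonal entries without bound, which kills them; a
  -- unipotent conjugation then turns a difference of diagonal entries into a large off-diagonal
  -- entry. The parameters are chosen to produce the value `K + 1`.
  have hdiag : ∀ t : ℝ, 0 < t → |x 0 1| * t ^ 2 ≤ K ∧ |x 1 0| * (1 / t) ^ 2 ≤ K := by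
    intro t ht
    let g : SL(2, ℝ) := ⟨!![t, 0; 0, 1 / t], by rw [Matrix.det_fin_two_of]; field_simp; ring⟩
    have hg' : g⁻¹.1 = !![1 / t, 0; 0, t] := by
      rw [Matrix.SpecialLinearGroup.SL2_inv_expl]
      ext i j
      fin_cases i <;> fin_cases j <;> simp [g]
    have h := hb g
    rw [hg', Matrix.eta_fin_two x, show g.1 = !![t, 0; 0, 1 / t] from rfl, Matrix.mul_fin_two,
      Matrix.mul_fin_two] at h
    simp only [Matrix.of_apply, Matrix.cons_val', Matrix.cons_val_zero, Matrix.cons_val_one,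
      Matrix.cons_val_fin_one] at h
    rw [← abs_of_pos (pow_pos ht 2), ← abs_of_pos (pow_pos (one_div_pos.2 ht) 2), ← abs_mul,
      ← abs_mul]
    ring_nf at h ⊢
    exact h
  have h01 : x 0 1 = 0 := by
    by_contra h0
    have hp := abs_pos.2 h0
    have h := (hdiag √((K + 1) / |x 0 1|) (by positivity)).1
    rw [Real.sq_sqrt (by positivity), mul_div_cancel₀ _ hp.ne'] at h
    linarith
  have h10 : x 1 0 = 0 := by
    by_contra h0
    have hp := abs_pos.2 h0
    have h := (hdiag (1 / √((K + 1) / |x 1 0|)) (by positivity)).2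
    rw [one_div_one_div, Real.sq_sqrt (by positivity), mul_div_cancel₀ _ hp.ne'] at h
    linarith
  rw [Matrix.exists_eq_smul_one_iff] at hx
  refine hx ⟨h01, h10, ?_⟩
  by_contra h0
  have hp := abs_pos.2 (sub_ne_zero.2 h0)
  let s := (K + 1) / |x 0 0 - x 1 1|
  let g : SL(2, ℝ) := ⟨!![1, s; 0, 1], by rw [Matrix.det_fin_two_of]; ring⟩
  have hg' : g⁻¹.1 = !![1, -s; 0, 1] := by
    rw [Matrix.SpecialLinearGroup.SL2_inv_expl]
    ext i j
    fin_cases i <;> fin_cases j <;> simp [g]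
  have h := (hb g).1
  rw [hg', Matrix.eta_fin_two x, show g.1 = !![1, s; 0, 1] from rfl, Matrix.mul_fin_two,
    Matrix.mul_fin_two] at h
  simp only [Matrix.of_apply, Matrix.cons_val', Matrix.cons_val_zero, Matrix.cons_val_one,
    Matrix.cons_val_fin_one, h01, h10] at h
  have h' : |(x 0 0 - x 1 1) * s| ≤ K := by
    rw [← abs_neg]; convert h using 2; ring
  rw [abs_mul, abs_of_nonneg (by positivity : 0 ≤ s), mul_div_cancel₀ _ hp.ne'] at h'
  linarith

/-- Otherwise the conjugation orbit of `x` would be a single point, hence bounded. -/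
theorem exists_not_commute (Γ : Subgroup SLTilde) [CompactSpace (SLTilde ⧸ Γ)]
    {x : Matrix (Fin 2) (Fin 2) ℝ} (hx : ¬ ∃ c : ℝ, x = c • 1) :
    ∃ γ ∈ Γ, ¬ Commute (proj γ).1 x := by
  obtain ⟨γ, hγ, i, j, hij⟩ := exists_lt_abs_conj (Γ := Γ) hx (∑ i, ∑ j, |x i j|)
  refine ⟨γ, hγ, fun h => hij.not_ge ?_⟩
  rw [h.eq, mul_assoc, ← Matrix.SpecialLinearGroup.coe_mul, mul_inv_cancel,
    Matrix.SpecialLinearGroup.coe_one, mul_one]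
  exact x.abs_apply_le_sum i j

theorem mem_center_iff [CompactSpace (SLTilde ⧸ Γ)] (γ : Γ) :
    γ ∈ Subgroup.center Γ ↔ proj γ = 1 ∨ proj γ = -1 := by
  constructor
  · intro h
    refine Matrix.SpecialLinearGroup.eq_one_or_eq_neg_one ?_
    by_contra hx
    obtain ⟨δ, hδ, hne⟩ := exists_not_commute Γ hx
    refine hne ?_
    have hcomm : (δ * γ : SLTilde) = γ * δ :=
      congrArg Subtype.val (Subgroup.mem_center_iff.1 h ⟨δ, hδ⟩)
    have := congrArg (fun p => (proj p).1) hcomm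
    simp only [map_mul, Matrix.SpecialLinearGroup.coe_mul] at this
    exact this
  · intro h
    exact Subgroup.mem_center_iff.2 fun δ => Subtype.ext (commute_of_proj h δ).symm

open scoped Topology in
-- The kernel of `proj` is central, so the commutator of `γ` with `δ` can be computed with the
-- principal lift of `proj γ` in place of `γ`. It is close to `1` when `proj γ` is, even if `γ` is
-- not, and discreteness of `Γ` makes it trivial.
theorem eventually_commute [DiscreteTopology Γ] {δ : SLTilde} (hδ : δ ∈ Γ) :
    ∀ᶠ g in 𝓝 (1 : SL(2, ℝ)), ∀ γ ∈ Γ, proj γ = g → Commute (proj γ) (proj δ) := by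
  obtain ⟨W, hW, hWΓ⟩ : ∃ W ∈ 𝓝 (1 : SLTilde), ∀ p ∈ Γ, p ∈ W → p = 1 := by
    have h : ({1} : Set Γ) ∈ 𝓝 (1 : Γ) := (isOpen_discrete _).mem_nhds rfl
    rw [nhds_subtype_eq_comap] at h
    obtain ⟨W, hW, hW'⟩ := h
    exact ⟨W, hW, fun p hp hpW => congrArg Subtype.val (@hW' ⟨p, hp⟩ hpW)⟩
  let s : logDomain → SLTilde := fun g => logLift g.1 (Or.inr g.2)
  have hone : (1 : SL(2, ℝ)) ∈ logDomain := by simp [logDomain]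
  have hs1 : s ⟨1, hone⟩ = 1 := logLift_one _
  have hc : Continuous fun g => s g * δ * (s g)⁻¹ * δ⁻¹ :=
    ((continuous_logLift.mul continuous_const).mul continuous_logLift.inv).mul continuous_const
  have h1 : ∀ᶠ g : logDomain in 𝓝 ⟨1, hone⟩, s g * δ * (s g)⁻¹ * δ⁻¹ ∈ W :=
    hc.continuousAt.eventually_mem (by rw [hs1]; simpa using hW)
  have hopen : IsOpen logDomain := isOpen_lt continuous_const (continuous_SL_apply 1 1)
  rw [nhds_subtype_eq_comap, eventually_comap] at h1
  filter_upwards [h1, hopen.mem_nhds hone] with g hg hgd γ hγ hγg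
  have h2 := hg ⟨g, hgd⟩ rfl
  set σ := s ⟨g, hgd⟩
  have hz : ∀ q, (γ⁻¹ * σ) * q = q * (γ⁻¹ * σ) := commute_of_proj (Or.inl (by
    rw [map_mul, map_inv, hγg]
    exact inv_mul_cancel g))
  have h3 : σ * δ * σ⁻¹ * δ⁻¹ = γ * δ * γ⁻¹ * δ⁻¹ := by
    have : σ = γ * (γ⁻¹ * σ) := (mul_inv_cancel_left _ _).symm
    calc σ * δ * σ⁻¹ * δ⁻¹ = γ * ((γ⁻¹ * σ) * δ) * σ⁻¹ * δ⁻¹ := by group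
      _ = γ * (δ * (γ⁻¹ * σ)) * σ⁻¹ * δ⁻¹ := by rw [hz]
      _ = _ := by group
  rw [h3] at h2
  have h4 := hWΓ _ (mul_mem (mul_mem (mul_mem hγ hδ) (inv_mem hγ)) (inv_mem hδ)) h2
  have h5 := congrArg proj h4
  simp only [map_mul, map_inv, map_one] at h5
  rwa [mul_inv_eq_one, mul_inv_eq_iff_eq_mul] at h5

open scoped Topology in
/-- The projection of a cocompact discrete subgroup to `SL(2, ℝ)` is discrete. -/
theorem exists_nhds_proj_eq_one [DiscreteTopology Γ] [CompactSpace (SLTilde ⧸ Γ)] :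
    ∃ V ∈ 𝓝 (1 : SL(2, ℝ)), ∀ γ ∈ Γ, proj γ ∈ V → proj γ = 1 := by
  -- Any nonscalar matrix would do: it only serves to find a nonscalar `δ`, and then a `δ'` that
  -- does not commute with it. What commutes with both is scalar, and `hpos` excludes `-1`.
  obtain ⟨δ, hδ, hne⟩ := exists_not_commute Γ (x := !![0, 1; 0, 0]) (by
    rw [Matrix.exists_eq_smul_one_iff]; simp)
  have hδ1 : ¬ ∃ c : ℝ, (proj δ).1 = c • 1 := by
    rintro ⟨c, hc⟩
    rw [hc] at hne
    exact hne ((Commute.one_left _).smul_left c)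
  obtain ⟨δ', hδ', hne'⟩ := exists_not_commute Γ hδ1
  have hval : Continuous fun g : SL(2, ℝ) => g.1 0 0 := continuous_SL_apply 0 0
  have hpos : ∀ᶠ g : SL(2, ℝ) in 𝓝 1, 0 < g.1 0 0 :=
    hval.continuousAt.eventually (lt_mem_nhds (by simp))
  refine ⟨_, (eventually_commute hδ).and ((eventually_commute hδ').and hpos), ?_⟩
  rintro γ hγ ⟨h1, h2, h3⟩
  have hsc : ∃ c : ℝ, (proj γ).1 = c • 1 := by
    by_contra hx
    exact hne' (Matrix.commute_of_commute_of_ne_smul_one hx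
      (congrArg Subtype.val (h2 γ hγ rfl).symm.eq) (congrArg Subtype.val (h1 γ hγ rfl).symm.eq))
  rcases Matrix.SpecialLinearGroup.eq_one_or_eq_neg_one hsc with h | h
  · exact h
  · rw [h] at h3
    simp at h3
    linarith

theorem isCompact_setOf_abs_apply_le (C : ℝ) :
    IsCompact {g : SL(2, ℝ) | ∀ i j, |g.1 i j| ≤ C} :=
  Matrix.SpecialLinearGroup.isClosedEmbedding_val.isCompact_preimage
    (Matrix.isCompact_setOf_abs_apply_le C)

/-- The elements of finite order of the projection of a cocompact discrete subgroup have bounded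
order. -/
theorem exists_forall_isOfFinOrder [DiscreteTopology Γ] [CompactSpace (SLTilde ⧸ Γ)] :
    ∃ N > 0, ∀ γ ∈ Γ, IsOfFinOrder (proj γ) → proj γ ^ N = 1 := by
  obtain ⟨R, hR⟩ := exists_bounded_representatives Γ
  obtain ⟨V, hV, hVΓ⟩ := exists_nhds_proj_eq_one (Γ := Γ)
  have hfin := Subgroup.finite_inter_of_isCompact (H := Γ.map proj) hV (by
    -- The compact set is that of the bound for a matrix with entries at most `1` conjugated by one
    -- with entries at most `R`. Every element of finite order has a `Γ`-conjugate in it, and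
    -- conjugation preserves the order.
    rintro _ ⟨γ, hγ, rfl⟩ h
    exact hVΓ γ hγ h) (isCompact_setOf_abs_apply_le (2 * (2 * (R * 1) * R)))
  obtain ⟨N, hN, h⟩ := hfin.exists_pow_eq_one
  refine ⟨N, hN, fun γ hγ hord => ?_⟩
  obtain ⟨k, hk⟩ : ∃ k : SL(2, ℝ), ∀ i j, |(k⁻¹ * proj γ * k).1 i j| ≤ 1 := by
    by_cases h1 : (proj γ).1 = 1
    · refine ⟨1, fun i j => ?_⟩
      rw [inv_one, one_mul, mul_one, h1]
      fin_cases i <;> fin_cases j <;> simp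
    by_cases h2 : (proj γ).1 = -1
    · refine ⟨1, fun i j => ?_⟩
      rw [inv_one, one_mul, mul_one, h2]
      fin_cases i <;> fin_cases j <;> simp
    obtain ⟨m, hm0, hm⟩ := isOfFinOrder_iff_pow_eq_one.1 hord
    refine Matrix.SpecialLinearGroup.exists_conj_abs_le_one
      (Matrix.abs_trace_lt_two (proj γ).2 hm0 ?_ h1 h2)
    rw [← Matrix.SpecialLinearGroup.coe_pow, hm, Matrix.SpecialLinearGroup.coe_one]
  obtain ⟨δ, hδ, hb⟩ := hR k⁻¹
  have hconj : proj (δ⁻¹ * γ * δ) = (k⁻¹ * proj δ)⁻¹ * (k⁻¹ * proj γ * k) * (k⁻¹ * proj δ) := by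
    simp only [map_mul, map_inv]
    group
  have hpow : proj (δ⁻¹ * γ * δ) ^ N = 1 := by
    refine h _ ⟨⟨_, mul_mem (mul_mem (inv_mem hδ) hγ) hδ, rfl⟩, ?_⟩ ?_
    · rw [hconj]
      exact Matrix.abs_mul_apply_le (Matrix.abs_mul_apply_le
        (Matrix.SpecialLinearGroup.abs_inv_apply_le hb) hk) hb
    · rw [isOfFinOrder_iff_pow_eq_one] at hord ⊢
      obtain ⟨m, hm0, hm⟩ := hord
      refine ⟨m, hm0, ?_⟩
      rw [map_mul, map_mul, map_inv]
      have := conj_pow (i := m) (a := (proj δ)⁻¹) (b := proj γ)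
      rw [inv_inv] at this
      rw [this, hm, mul_one, inv_mul_cancel]
  rw [map_mul, map_mul, map_inv] at hpow
  have := conj_pow (i := N) (a := (proj δ)⁻¹) (b := proj γ)
  rw [inv_inv] at this
  rw [this, mul_assoc, inv_mul_eq_one, eq_comm, mul_eq_right] at hpow
  exact hpow

end SLTilde

/-! ### Discreteness of groups of saddles -/

namespace Matrix

/-- The characteristic polynomial has a root outside and a root inside the unit disc. -/
def IsSaddle (A : Matrix (Fin 2) (Fin 2) ℝ) : Prop :=
  ∃ a b : ℝ, 1 < |a| ∧ |b| < 1 ∧ A.trace = a + b ∧ A.det = a * b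

theorem IsSaddle.trace_ne_zero {A : Matrix (Fin 2) (Fin 2) ℝ} (h : A.IsSaddle) : A.trace ≠ 0 := by
  obtain ⟨a, b, ha, hb, ht, -⟩ := h
  rw [ht]
  intro h0
  rw [eq_neg_of_add_eq_zero_left h0, abs_neg] at ha
  exact ha.not_gt hb

theorem IsSaddle.disc_pos {A : Matrix (Fin 2) (Fin 2) ℝ} (h : A.IsSaddle) :
    4 * A.det < A.trace ^ 2 := by
  obtain ⟨a, b, ha, hb, ht, hd⟩ := h
  rw [ht, hd]
  have hab : a - b ≠ 0 := fun h0 => by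
    rw [sub_eq_zero.1 h0] at ha
    exact ha.not_gt hb
  have : 0 < (a - b) ^ 2 := by positivity
  linarith [sq_nonneg (a - b), show (a + b) ^ 2 = (a - b) ^ 2 + 4 * (a * b) by ring]

theorem ne_smul_one_of_disc {A : Matrix (Fin 2) (Fin 2) ℝ} (hA : A.trace ^ 2 ≠ 4 * A.det) :
    ¬ ∃ c : ℝ, A = c • 1 := by
  rintro ⟨c, rfl⟩
  refine hA ?_
  simp
  ring

theorem exists_eq_smul_add_smul {A C : Matrix (Fin 2) (Fin 2) ℝ} (hA : ¬ ∃ c : ℝ, A = c • 1)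
    (h : Commute A C) : ∃ p q : ℝ, C = p • 1 + q • A := by
  rw [exists_eq_smul_one_iff] at hA
  rw [commute_fin_two_iff] at h
  obtain ⟨h1, h2, h3⟩ := h
  obtain ⟨q, e1, e2, e3⟩ : ∃ q : ℝ, C 0 1 = q * A 0 1 ∧ C 1 0 = q * A 1 0 ∧
      C 0 0 - C 1 1 = q * (A 0 0 - A 1 1) := by
    by_cases hA1 : A 0 1 = 0
    · by_cases hA2 : A 1 0 = 0
      · have hA3 : A 0 0 - A 1 1 ≠ 0 := fun h => hA ⟨hA1, hA2, sub_eq_zero.1 h⟩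
        refine ⟨(C 0 0 - C 1 1) / (A 0 0 - A 1 1), ?_, ?_, ?_⟩ <;> field_simp <;> linarith
      · refine ⟨C 1 0 / A 1 0, ?_, ?_, ?_⟩ <;> field_simp <;> linarith
    · refine ⟨C 0 1 / A 0 1, ?_, ?_, ?_⟩ <;> field_simp <;> linarith
  refine ⟨C 0 0 - q * A 0 0, q, ?_⟩
  ext i j
  fin_cases i <;> fin_cases j <;> simp <;> linarith

/-- Writing `C = p + q A`, the discriminant of `C` is `q ^ 2` times that of `A`, so `q = ±1`, and
the trace gives `p`. The second case is the adjugate, with the two eigenvalues exchanged. -/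
theorem eq_or_eq_of_commute {A C : Matrix (Fin 2) (Fin 2) ℝ} (hA : A.trace ^ 2 ≠ 4 * A.det)
    (h : Commute A C) (ht : C.trace = A.trace) (hd : C.det = A.det) :
    C = A ∨ C = A.trace • 1 - A := by
  obtain ⟨p, q, rfl⟩ := exists_eq_smul_add_smul (ne_smul_one_of_disc hA) h
  simp only [trace_fin_two, det_fin_two, add_apply, smul_apply, one_apply, smul_eq_mul] at hA ht hd
  simp at ht hd
  have hp : p = (1 - q) * (A 0 0 + A 1 1) / 2 := by linarith
  have hq : (1 - q) * (1 + q) = 0 := by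
    apply mul_right_cancel₀ (sub_ne_zero.2 hA)
    rw [hp] at hd
    linear_combination 4 * hd
  rcases mul_eq_zero.1 hq with h | h
  · left
    have h1 : q = 1 := by linarith
    rw [hp, h1]; simp
  · right
    have h1 : q = -1 := by linarith
    rw [hp, h1, trace_fin_two, neg_one_smul, ← sub_eq_add_neg]
    congr 2
    ring

/-- `B` anticommutes with the trace-free part `A₀` of `A`. Trace-free matrices have scalar
anticommutators, so `B.trace • A₀` is scalar and trace-free, hence zero. -/
theorem trace_eq_zero_of_anticommute {A B : Matrix (Fin 2) (Fin 2) ℝ} (hA : ¬ ∃ c : ℝ, A = c • 1)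
    (h : B * A = (A.trace • 1 - A) * B) : B.trace = 0 := by
  by_contra hB
  apply hA
  rw [exists_eq_smul_one_iff]
  rw [← Matrix.ext_iff] at h
  simp only [Fin.forall_fin_two, mul_apply, Fin.sum_univ_two, sub_apply, smul_apply, one_apply,
    trace_fin_two, smul_eq_mul] at h
  simp at h
  rw [trace_fin_two] at hB
  obtain ⟨⟨h1, h2⟩, h3, h4⟩ := h
  refine ⟨?_, ?_, ?_⟩
  · apply (mul_eq_zero.1 (?_ : (B 0 0 + B 1 1) * A 0 1 = 0)).resolve_left hB
    linarith
  · apply (mul_eq_zero.1 (?_ : (B 0 0 + B 1 1) * A 1 0 = 0)).resolve_left hB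
    linarith
  · apply mul_left_cancel₀ hB
    linarith

/-- Fricke's trace identity, made homogeneous by replacing inverses with adjugates. -/
theorem trace_commutator_adjugate (A B : Matrix (Fin 2) (Fin 2) ℝ) :
    (A * B * A.adjugate * B.adjugate).trace = A.trace ^ 2 * B.det + B.trace ^ 2 * A.det +
      (A * B).trace ^ 2 - A.trace * B.trace * (A * B).trace - 2 * A.det * B.det := by
  simp only [adjugate_fin_two, trace_fin_two, det_fin_two, mul_apply, Fin.sum_univ_two, of_apply,
    cons_val', cons_val_zero, cons_val_one, cons_val_fin_one]
  ring

/-! ### Jørgensen's argument -/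

namespace GeneralLinearGroup

theorem val_inv_eq (A : GL (Fin 2) ℝ) : (A⁻¹).1 = A.1.det⁻¹ • A.1.adjugate := by
  rw [Matrix.coe_units_inv, Matrix.inv_def, Ring.inverse_eq_inv']

theorem det_val_ne_zero (A : GL (Fin 2) ℝ) : A.1.det ≠ 0 :=
  (Matrix.isUnits_det_units A).ne_zero

theorem trace_conj (A g : GL (Fin 2) ℝ) : (g * A * g⁻¹).1.trace = A.1.trace := by
  rw [Units.val_mul, Matrix.trace_mul_comm, ← Units.val_mul, ← mul_assoc, inv_mul_cancel, one_mul]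

theorem det_conj (A g : GL (Fin 2) ℝ) : (g * A * g⁻¹).1.det = A.1.det := by
  rw [Units.val_mul, Matrix.det_mul_comm, ← Units.val_mul, ← mul_assoc, inv_mul_cancel, one_mul]

/-- `2` minus the trace of the commutator. -/
noncomputable def commDefect (A g : GL (Fin 2) ℝ) : ℝ := 2 - (A * g * A⁻¹ * g⁻¹).1.trace

/-- The discriminant of the unimodular part. -/
noncomputable def normDisc (A : GL (Fin 2) ℝ) : ℝ := A.1.trace ^ 2 / A.1.det - 4

/-- Jørgensen's recursion. Besides the trace and determinant of `A`, both defects depend only on the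
trace of `A * (g * A * g⁻¹)`. -/
theorem commDefect_conj (A g : GL (Fin 2) ℝ) :
    commDefect A (g * A * g⁻¹) = -commDefect A g * (normDisc A + commDefect A g) := by
  have hd := det_val_ne_zero A
  have hadj : A.1.adjugate = A.1.trace • 1 - A.1 := by
    ext i j
    fin_cases i <;> fin_cases j <;> simp [adjugate_fin_two, trace_fin_two]
  have h1 : (A * g * A⁻¹ * g⁻¹).1.trace =
      A.1.det⁻¹ * (A.1.trace ^ 2 - (A * (g * A * g⁻¹)).1.trace) := by
    have e : (A * g * A⁻¹ * g⁻¹).1 =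
        A.1.det⁻¹ • (A.1.trace • A.1 - (A * (g * A * g⁻¹)).1) := by
      simp only [Units.val_mul, val_inv_eq A, hadj]
      have hgg : g.1 * (g⁻¹).1 = 1 := by rw [← Units.val_mul, mul_inv_cancel, Units.val_one]
      rw [mul_smul_comm, smul_mul_assoc, mul_sub, sub_mul, mul_smul_comm, smul_mul_assoc, mul_one,
        mul_assoc A.1 g.1 (g⁻¹).1, hgg, mul_one]
      simp only [mul_assoc]
    rw [e, trace_smul, trace_sub, trace_smul, smul_eq_mul, smul_eq_mul, sq]
  have h2 : (A * (g * A * g⁻¹) * A⁻¹ * (g * A * g⁻¹)⁻¹).1.trace =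
      A.1.det⁻¹ ^ 2 * (2 * A.1.trace ^ 2 * A.1.det + (A * (g * A * g⁻¹)).1.trace ^ 2 -
        A.1.trace ^ 2 * (A * (g * A * g⁻¹)).1.trace - 2 * A.1.det ^ 2) := by
    have e : (A * (g * A * g⁻¹) * A⁻¹ * (g * A * g⁻¹)⁻¹).1 = A.1.det⁻¹ ^ 2 •
        (A.1 * (g * A * g⁻¹).1 * A.1.adjugate * (g * A * g⁻¹).1.adjugate) := by
      rw [Units.val_mul, Units.val_mul, Units.val_mul, val_inv_eq A, val_inv_eq (g * A * g⁻¹),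
        det_conj, mul_smul_comm, mul_smul_comm, smul_mul_assoc, smul_smul, sq]
    rw [e, trace_smul, trace_commutator_adjugate, trace_conj, det_conj, ← Units.val_mul,
      smul_eq_mul]
    ring
  rw [commDefect, commDefect, normDisc, h1, h2]
  field_simp
  ring

theorem det_commutator (A g : GL (Fin 2) ℝ) : (A * g * A⁻¹ * g⁻¹).1.det = 1 := by
  have hA := det_val_ne_zero A
  have hg := det_val_ne_zero g
  rw [Units.val_mul, Units.val_mul, Units.val_mul, det_mul, det_mul, det_mul, coe_units_inv,
    coe_units_inv, det_nonsing_inv, det_nonsing_inv, Ring.inverse_eq_inv']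
  field_simp

theorem commute_of_commutator_eq_one {A g : GL (Fin 2) ℝ} (h : A * g * A⁻¹ * g⁻¹ = 1) :
    Commute A g := by
  rwa [mul_inv_eq_one, mul_inv_eq_iff_eq_mul] at h

/-- If `g A g⁻¹` commutes with `A`, then so does `g`, unless it exchanges the eigenlines. -/
theorem commute_of_commute_conj {A g : GL (Fin 2) ℝ} (hA : A.1.trace ^ 2 ≠ 4 * A.1.det)
    (hg : g.1.trace ≠ 0) (h : Commute A (g * A * g⁻¹)) : Commute A g := by
  rcases eq_or_eq_of_commute hA (congrArg Units.val h.eq) (trace_conj A g) (det_conj A g) with e | e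
  · have e' : g * A * g⁻¹ = A := Units.ext e
    rw [mul_inv_eq_iff_eq_mul] at e'
    exact e'.symm
  · refine absurd (trace_eq_zero_of_anticommute (ne_smul_one_of_disc hA) ?_) hg
    rw [← e, ← Units.val_mul, ← Units.val_mul, inv_mul_cancel_right]

variable {P : Subgroup (GL (Fin 2) ℝ)} {ε : ℝ}

/-- A form of Jørgensen's inequality. -/
theorem commute_of_commDefect_lt
    (hgap : ∀ g ∈ P, g.1.det = 1 → 2 - ε < g.1.trace → g.1.trace ≤ 2 → g = 1) (hε : ε ≤ 1 / 2)
    {A B : GL (Fin 2) ℝ} (hA : A ∈ P) (hB : B ∈ P) (hdet : 0 < A.1.det)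
    (hD : 0 < normDisc A) (hD' : normDisc A ≤ 1 / 2) (htr : B.1.trace = A.1.trace)
    (hAB : |commDefect A B| < ε) : Commute A B := by
  by_contra hne
  have hdisc : A.1.trace ^ 2 ≠ 4 * A.1.det := by
    intro h
    rw [normDisc, h, mul_div_cancel_right₀ _ hdet.ne', sub_self] at hD
    exact hD.false
  have htr0 : A.1.trace ≠ 0 := by
    intro h
    rw [normDisc, h] at hD
    norm_num at hD
  -- A small nonnegative defect puts the trace of the commutator in the gap, so that the commutator
  -- is trivial.
  have hneg : ∀ C ∈ P, ¬ Commute A C → |commDefect A C| < ε → commDefect A C < 0 := by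
    intro C hC hAC hlt
    by_contra! h0
    refine hAC (commute_of_commutator_eq_one (hgap _ ?_ (det_commutator A C) ?_ ?_))
    · exact mul_mem (mul_mem (mul_mem hA hC) (inv_mem hA)) (inv_mem hC)
    · rw [abs_of_nonneg h0, commDefect] at hlt
      linarith
    · rw [commDefect] at h0
      linarith
  have hstep : ∀ C ∈ P, ¬ Commute A C → C.1.trace = A.1.trace →
      ¬ Commute A (C * A * C⁻¹) := fun C _ hAC hC h =>
    hAC (commute_of_commute_conj hdisc (hC ▸ htr0) h)
  -- Iterating `C ↦ C A C⁻¹` multiplies the defect `w` by `-(D + w)`, with `D = normDisc A`. As `0 <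
  -- D ≤ 1/2` and `-1/2 < w < 0`, this factor is at most `1/2` in absolute value.
  have hseq : ∀ k : ℕ, ∃ C ∈ P, ¬ Commute A C ∧ C.1.trace = A.1.trace ∧
      |commDefect A C| < ε * (1 / 2) ^ k := by
    intro k
    induction k with
    | zero => exact ⟨B, hB, hne, htr, by simpa using hAB⟩
    | succ k ih =>
      obtain ⟨C, hC, hAC, hCt, hlt⟩ := ih
      have hε0 : 0 ≤ ε := (abs_nonneg _).trans hAB.le
      have hlt' : |commDefect A C| < ε := hlt.trans_le
        (mul_le_of_le_one_right hε0 (pow_le_one₀ (by norm_num) (by norm_num)))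
      have h0 := hneg C hC hAC hlt'
      refine ⟨C * A * C⁻¹, mul_mem (mul_mem hC hA) (inv_mem hC), hstep C hC hAC hCt,
        trace_conj A C, ?_⟩
      rw [commDefect_conj, abs_mul, abs_neg, pow_succ, ← mul_assoc]
      rw [abs_of_neg h0] at hlt'
      refine mul_lt_mul hlt ?_ (abs_pos.2 ?_) ((abs_nonneg _).trans hlt.le)
      · rw [abs_le]; constructor <;> linarith
      · intro h
        have h1 := commDefect_conj A C
        rw [h, mul_zero] at h1
        have h2 := hneg (C * A * C⁻¹) (mul_mem (mul_mem hC hA) (inv_mem hC))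
          (hstep C hC hAC hCt) (by rw [h1, abs_zero]; linarith)
        linarith
  have hε0 : 0 < ε := (abs_nonneg _).trans_lt hAB
  -- Once `|w| < D`, the next defect `-w (D + w)` is positive, against `hneg`.
  obtain ⟨k, hk⟩ := exists_pow_lt_of_lt_one (div_pos hD hε0) (by norm_num : (1 / 2 : ℝ) < 1)
  obtain ⟨C, hC, hAC, hCt, hlt⟩ := hseq k
  have hlt' : |commDefect A C| < ε := hlt.trans_le
    (mul_le_of_le_one_right hε0.le (pow_le_one₀ (by norm_num) (by norm_num)))
  have h0 := hneg C hC hAC hlt'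
  rw [lt_div_iff₀ hε0, mul_comm] at hk
  have hlt2 := hlt.trans hk
  rw [abs_of_neg h0] at hlt2 hlt'
  have h1 := commDefect_conj A C
  have hpos : 0 < commDefect A (C * A * C⁻¹) := by
    rw [h1]
    exact mul_pos (by linarith) (by linarith)
  refine (hneg (C * A * C⁻¹) (mul_mem (mul_mem hC hA) (inv_mem hC))
    (hstep C hC hAC hCt) ?_).not_gt hpos
  rw [abs_of_pos hpos, h1]
  nlinarith

/-- A gap in the traces of a group of saddles and elements of bounded order. -/
theorem exists_gap {M : ℕ} (hM : 0 < M) (hP : ∀ g ∈ P, g ^ M = 1 ∨ g.1.IsSaddle) :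
    ∃ ε > 0, ε ≤ 1 / 2 ∧
      (∀ g ∈ P, g.1.det = 1 → 2 - ε < g.1.trace → g.1.trace ≤ 2 → g = 1) ∧
      ∀ g : GL (Fin 2) ℝ, g.1.det = 1 → g ^ M = 1 → |g.1.trace - 2| < ε → g = 1 := by
  obtain ⟨ε, hε, h⟩ := Matrix.exists_trace_gap hM
  have hpow : ∀ g : GL (Fin 2) ℝ, g ^ M = 1 → g.1 ^ M = 1 := fun g hg => by
    rw [← Units.val_pow_eq_pow_val, hg, Units.val_one]
  refine ⟨min ε (1 / 2), by positivity, min_le_right _ _, fun g hg hd h1 h2 => ?_,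
    fun g hd hg h1 => Units.ext (h g.1 hd (hpow g hg) (h1.trans_le (min_le_left _ _)))⟩
  have he1 := min_le_left ε (1 / 2)
  have he2 := min_le_right ε (1 / 2)
  rcases hP g hg with hgM | ⟨a, b, ha, hb, ht, hab⟩
  · refine Units.ext (h g.1 hd (hpow g hgM) ?_)
    rw [abs_lt]; constructor <;> linarith
  · exfalso
    rw [hd] at hab
    rw [ht] at h1 h2
    have ha0 : a ≠ 0 := by rintro rfl; simp at hab
    -- A unimodular saddle has `b = 1 / a`, so its trace is negative or larger than `2`.
    rcases lt_or_gt_of_ne ha0 with h0 | h0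
    · have : b < 0 := by
        by_contra! hb0
        nlinarith
      linarith
    · rw [abs_of_pos h0] at ha
      nlinarith [sq_nonneg (a - 1), mul_pos (sub_pos.2 ha) (sub_pos.2 ha)]

theorem continuous_trace : Continuous fun A : GL (Fin 2) ℝ => A.1.trace :=
  Units.continuous_val.matrix_trace

theorem det_eq_one_of_pow_eq_one {M : ℕ} (hM : 0 < M) {g : GL (Fin 2) ℝ} (hdet : 0 < g.1.det)
    (hg : g ^ M = 1) : g.1.det = 1 := by
  refine (pow_eq_one_iff_of_nonneg hdet.le hM.ne').1 ?_
  rw [← det_pow, ← Units.val_pow_eq_pow_val, hg, Units.val_one, det_one]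

open scoped Topology in
-- Nontrivial elements of order dividing `M` have traces away from `2`.
theorem eventually_isSaddle {M : ℕ} (hM : 0 < M) (hP : ∀ g ∈ P, g ^ M = 1 ∨ g.1.IsSaddle)
    (hdet : ∀ g ∈ P, 0 < g.1.det) :
    ∀ᶠ A in 𝓝 (1 : GL (Fin 2) ℝ), A ∈ P → A ≠ 1 → A.1.IsSaddle := by
  obtain ⟨ε, hε, -, -, hgap⟩ := exists_gap hM hP
  have hT : ∀ᶠ A in 𝓝 (1 : GL (Fin 2) ℝ), |A.1.trace - 2| < ε := by
    have : Continuous fun A : GL (Fin 2) ℝ => |A.1.trace - 2| :=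
      (continuous_trace.sub continuous_const).abs
    exact this.continuousAt.eventually (gt_mem_nhds (by simpa))
  filter_upwards [hT] with A hA hAP hne
  exact (hP A hAP).resolve_left fun hAM =>
    hne (hgap A (det_eq_one_of_pow_eq_one hM (hdet A hAP) hAM) hAM hA)

open scoped Topology in
/-- In a nondiscrete group of saddles and elements of bounded order, all saddles have the same
eigenlines. -/
theorem conj_eq_or_eq_of_not_discrete {M : ℕ} (hM : 0 < M)
    (hP : ∀ g ∈ P, g ^ M = 1 ∨ g.1.IsSaddle) (hdet : ∀ g ∈ P, 0 < g.1.det)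
    (hnd : ∀ V ∈ 𝓝 (1 : GL (Fin 2) ℝ), ∃ g ∈ P, g ∈ V ∧ g ≠ 1)
    {h g : GL (Fin 2) ℝ} (hh : h ∈ P) (hs : h.1.IsSaddle) (hg : g ∈ P) :
    (g * h * g⁻¹).1 = h.1 ∨ (g * h * g⁻¹).1 = h.1.det • (h⁻¹).1 := by
  obtain ⟨ε, hε, hε', hgap, -⟩ := exists_gap hM hP
  have htr := continuous_trace
  have hdt : Continuous fun A : GL (Fin 2) ℝ => A.1.det := Units.continuous_val.matrix_det
  have hone : (1 : GL (Fin 2) ℝ).1.trace = 2 := by simp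
  have hone' : (1 : GL (Fin 2) ℝ).1.det = 1 := by simp
  have hD : ∀ᶠ A in 𝓝 (1 : GL (Fin 2) ℝ), normDisc A < 1 / 2 := by
    have : ContinuousAt normDisc 1 := by
      refine ((htr.pow 2).continuousAt.div hdt.continuousAt ?_).sub continuousAt_const
      rw [hone']; norm_num
    refine this.eventually (gt_mem_nhds ?_)
    rw [normDisc, hone, hone']; norm_num
  have hw : ∀ k : GL (Fin 2) ℝ, ∀ᶠ A in 𝓝 (1 : GL (Fin 2) ℝ),
      |commDefect A (k * A * k⁻¹)| < ε := by
    intro k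
    have : Continuous fun A : GL (Fin 2) ℝ => |commDefect A (k * A * k⁻¹)| := by
      refine (continuous_const.sub (htr.comp ?_)).abs
      fun_prop
    refine this.continuousAt.eventually (gt_mem_nhds ?_)
    simp [commDefect, hε]
  have hk : g * h * g⁻¹ ∈ P := mul_mem (mul_mem hg hh) (inv_mem hg)
  -- One saddle `A` so close to `1` that the Jørgensen argument makes it commute with both `h` and
  -- `g h g⁻¹`. These then commute with each other, as the centralizer of `A` is commutative.
  obtain ⟨A, hA, ⟨⟨hA1, hA2⟩, hA3, hA4⟩, hne⟩ :=
    hnd _ ((hD.and (eventually_isSaddle hM hP hdet)).and ((hw h).and (hw (g * h * g⁻¹))))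
  have hAs := hA2 hA hne
  have hdA := hdet A hA
  have hDA : 0 < normDisc A := by
    rw [normDisc, sub_pos, lt_div_iff₀ hdA]
    exact hAs.disc_pos
  have hcomm : ∀ k ∈ P, k.1.trace ≠ 0 → |commDefect A (k * A * k⁻¹)| < ε → Commute A k :=
    fun k hk hk0 hlt => commute_of_commute_conj hAs.disc_pos.ne' hk0
      (commute_of_commDefect_lt hgap hε' hA (mul_mem (mul_mem hk hA) (inv_mem hk)) hdA hDA hA1.le
        (trace_conj A k) hlt)
  have c1 := hcomm h hh hs.trace_ne_zero hA3
  have c2 := hcomm (g * h * g⁻¹) hk (by rw [trace_conj]; exact hs.trace_ne_zero) hA4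
  have c3 : Commute h.1 (g * h * g⁻¹).1 := commute_of_commute_of_ne_smul_one
    (ne_smul_one_of_disc hAs.disc_pos.ne') (congrArg Units.val c1.eq.symm)
    (congrArg Units.val c2.eq.symm)
  refine (eq_or_eq_of_commute hs.disc_pos.ne' c3 (trace_conj h g) (det_conj h g)).imp_right ?_
  intro e
  rw [e, val_inv_eq, smul_smul, mul_inv_cancel₀ (det_val_ne_zero h), one_smul]
  ext i j
  fin_cases i <;> fin_cases j <;> simp [adjugate_fin_two, trace_fin_two]

end GeneralLinearGroup

end Matrix

/-! ### Spectral radius and stable norm -/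

section SpectralRadius

variable (A : Matrix (Fin 2) (Fin 2) ℝ)

attribute [local instance] Matrix.linftyOpNormedRing Matrix.linftyOpNormedAlgebra
  Matrix.linfty_opNormOneClass

theorem spectralRadius_map_le {a : ℝ} (hA : ∀ i j, |A i j| ≤ a) :
    spectralRadius ℂ (A.map (algebraMap ℝ ℂ)) ≤ ENNReal.ofReal (2 * a) := by
  have : CompleteSpace (Matrix (Fin 2) (Fin 2) ℂ) := FiniteDimensional.complete ℂ _
  refine (spectrum.spectralRadius_le_nnnorm _).trans ?_
  refine ENNReal.coe_le_coe.2 ?_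
  rw [Matrix.linfty_opNNNorm_def]
  refine Finset.sup_le fun i _ => ?_
  rw [Fin.sum_univ_two, ← NNReal.coe_le_coe]
  have h0 : 0 ≤ a := (abs_nonneg _).trans (hA 0 0)
  have h1 := hA i 0
  have h2 := hA i 1
  simp [h0]
  linarith

theorem spectralRadius_map_ne_top : spectralRadius ℂ (A.map (algebraMap ℝ ℂ)) ≠ ⊤ := by
  have : CompleteSpace (Matrix (Fin 2) (Fin 2) ℂ) := FiniteDimensional.complete ℂ _
  exact ((spectrum.spectralRadius_le_nnnorm _).trans_lt ENNReal.coe_lt_top).ne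

end SpectralRadius

theorem norm_le_spectralRadius_map {A : Matrix (Fin 2) (Fin 2) ℝ} {μ : ℂ}
    (h : μ ∈ spectrum ℂ (A.map (algebraMap ℝ ℂ))) :
    ‖μ‖ ≤ (spectralRadius ℂ (A.map (algebraMap ℝ ℂ))).toReal := by
  have h1 : (‖μ‖₊ : ENNReal) ≤ spectralRadius ℂ (A.map (algebraMap ℝ ℂ)) :=
    le_iSup₂ (f := fun (k : ℂ) (_ : k ∈ spectrum ℂ (A.map (algebraMap ℝ ℂ))) => (‖k‖₊ : ENNReal)) μ h
  have := ENNReal.toReal_mono (spectralRadius_map_ne_top A) h1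
  simpa using this

theorem abs_det_le_spectralRadius_sq (A : Matrix (Fin 2) (Fin 2) ℝ) :
    |A.det| ≤ (spectralRadius ℂ (A.map (algebraMap ℝ ℂ))).toReal ^ 2 := by
  set C := A.map (algebraMap ℝ ℂ) with hC
  obtain ⟨μ, hμ⟩ := IsAlgClosed.exists_root C.charpoly (by
    rw [Matrix.charpoly_degree_eq_dim]; simp)
  have hμ' : C.charpoly.IsRoot (C.trace - μ) := by
    rw [Polynomial.IsRoot, Matrix.charpoly_fin_two] at hμ ⊢
    simp at hμ ⊢
    linear_combination hμ
  have hd : μ * (C.trace - μ) = (A.det : ℂ) := by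
    rw [Polynomial.IsRoot, Matrix.charpoly_fin_two] at hμ
    simp at hμ
    have hCd : C.det = (A.det : ℂ) := by simp [hC, Matrix.det_fin_two]
    rw [← hCd]
    linear_combination -hμ
  have h1 := norm_le_spectralRadius_map (Matrix.mem_spectrum_iff_isRoot_charpoly.2 hμ)
  have h2 := norm_le_spectralRadius_map (Matrix.mem_spectrum_iff_isRoot_charpoly.2 hμ')
  have h3 := congrArg (‖·‖) hd
  simp only [norm_mul, Complex.norm_real, Real.norm_eq_abs] at h3
  rw [← h3, sq]
  exact mul_le_mul h1 h2 (norm_nonneg _) ((norm_nonneg _).trans h1)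

theorem spectralRadius_map_pow_le (A : Matrix (Fin 2) (Fin 2) ℝ) {n : ℕ} (hn : 0 < n) :
    (spectralRadius ℂ ((A ^ n).map (algebraMap ℝ ℂ))).toReal ≤
      (spectralRadius ℂ (A.map (algebraMap ℝ ℂ))).toReal ^ n := by
  rw [← ENNReal.toReal_pow]
  refine ENNReal.toReal_mono (ENNReal.pow_ne_top (spectralRadius_map_ne_top A)) ?_
  refine iSup₂_le fun k hk => ?_
  rw [Matrix.map_pow, spectrum.map_pow_of_pos _ hn] at hk
  obtain ⟨μ, hμ, rfl⟩ := hk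
  simp only [nnnorm_pow, ENNReal.coe_pow]
  gcongr
  exact le_iSup₂
    (f := fun (k : ℂ) (_ : k ∈ spectrum ℂ (A.map (algebraMap ℝ ℂ))) => (‖k‖₊ : ENNReal)) μ hμ

/-! ### Geodesic length and the homothety factor -/

section Hyperbolic

variable {G : Type*} [Group G] (ρ : G →* GL0)

theorem GL0.det_pos (g : GL0) : 0 < g.1.1.det := g.2

theorem GL0.spectralRadius_ge (g : GL0) :
    √g.1.1.det ≤ (spectralRadius ℂ (g.1.1.map (algebraMap ℝ ℂ))).toReal := by
  refine Real.sqrt_le_left ENNReal.toReal_nonneg |>.2 ?_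
  exact (le_abs_self _).trans (abs_det_le_spectralRadius_sq _)

theorem geodesicLength_nonneg (γ : G) : 0 ≤ geodesicLength ρ γ := by
  have h0 := Real.sqrt_pos.2 (ρ γ).det_pos
  exact mul_nonneg zero_le_two (Real.log_nonneg ((one_le_div h0).2 (ρ γ).spectralRadius_ge))

theorem geodesicLength_pow_le (γ : G) {n : ℕ} (hn : 0 < n) :
    geodesicLength ρ (γ ^ n) ≤ n * geodesicLength ρ γ := by
  have h0 := Real.sqrt_pos.2 (ρ γ).det_pos
  have h1 := Real.sqrt_pos.2 (ρ (γ ^ n)).det_pos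
  have h2 := (ρ (γ ^ n)).spectralRadius_ge
  have hm : (ρ (γ ^ n)).1.1 = (ρ γ).1.1 ^ n := by rw [map_pow]; rfl
  have hs : √(ρ (γ ^ n)).1.1.det = √(ρ γ).1.1.det ^ n := by
    rw [hm, Matrix.det_pow, Real.sqrt_eq_iff_mul_self_eq_of_pos (by positivity), ← mul_pow,
      Real.mul_self_sqrt (ρ γ).det_pos.le]
  rw [geodesicLength, geodesicLength, mul_left_comm, ← Real.log_pow, div_pow, ← hs]
  refine mul_le_mul_of_nonneg_left (Real.log_le_log (div_pos (h1.trans_le h2) h1) ?_) zero_le_two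
  gcongr
  rw [hm]
  exact spectralRadius_map_pow_le _ hn

theorem homologyClass_pow (γ : G) (n : ℕ) : homologyClass (γ ^ n) = n • homologyClass γ := by
  rw [homologyClass, homologyClass, ← ofMul_pow, ← map_pow]
  rfl

/-- The powers `γ ^ n` compete in the infima, and length is at most multiplicative on them. -/
theorem stableNorm_le (γ : G) : stableNorm ρ (homologyClass γ) ≤ geodesicLength ρ γ := by
  have hpos : ∀ n : ℕ, ∀ s ∈ {s : ℝ | ∃ δ : G, homologyClass δ = n • homologyClass γ ∧
      s = geodesicLength ρ δ / n}, 0 ≤ s := by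
    rintro n s ⟨δ, -, rfl⟩
    exact div_nonneg (geodesicLength_nonneg ρ δ) n.cast_nonneg
  refine liminf_le_of_frequently_le (Eventually.frequently ?_)
    ⟨0, eventually_map.2 (Eventually.of_forall fun n : ℕ => Real.sInf_nonneg (hpos n))⟩
  filter_upwards [eventually_gt_atTop 0] with n hn
  refine (csInf_le ⟨0, hpos n⟩ ⟨γ ^ n, homologyClass_pow γ n, rfl⟩).trans ?_
  rw [div_le_iff₀ (by exact_mod_cast hn), mul_comm]
  exact geodesicLength_pow_le ρ γ hn

variable {ρ}

theorem abs_logFactor_le (hρ : dualStableNorm ρ ≠ ⊤) (γ : G) :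
    |logFactor ρ γ| ≤ (dualStableNorm ρ).toReal * geodesicLength ρ γ := by
  have h : ENNReal.ofReal |logFactor ρ γ| / ENNReal.ofReal (stableNorm ρ (homologyClass γ)) ≤
      dualStableNorm ρ := le_iSup (fun γ : G => ENNReal.ofReal |logFactor ρ γ| /
        ENNReal.ofReal (stableNorm ρ (homologyClass γ))) γ
  have ht := geodesicLength_nonneg ρ γ
  rcases le_or_gt (stableNorm ρ (homologyClass γ)) 0 with hs | hs
  -- Here the denominator is `0` in `ℝ≥0∞`, and the quotient is `∞` unless the numerator vanishes.
  · have h0 : |logFactor ρ γ| = 0 := by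
      by_contra h0
      rw [ENNReal.ofReal_of_nonpos hs, ENNReal.div_zero] at h
      · exact hρ (top_le_iff.1 h)
      · rw [Ne, ENNReal.ofReal_eq_zero, not_le]
        exact lt_of_le_of_ne (abs_nonneg _) (Ne.symm h0)
    rw [h0]
    positivity
  · have h1 := ENNReal.toReal_mono hρ h
    rw [ENNReal.toReal_div, ENNReal.toReal_ofReal (abs_nonneg _), ENNReal.toReal_ofReal hs.le,
      div_le_iff₀ hs] at h1
    exact h1.trans (mul_le_mul_of_nonneg_left (stableNorm_le ρ γ) ENNReal.toReal_nonneg)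

theorem geodesicLength_le {γ : G} {a : ℝ} (ha : ∀ i j, |(ρ γ).1.1 i j| ≤ a) :
    geodesicLength ρ γ ≤ 2 * Real.log (2 * a / √(ρ γ).1.1.det) := by
  have h0 := Real.sqrt_pos.2 (ρ γ).det_pos
  have h1 := (ρ γ).spectralRadius_ge
  refine mul_le_mul_of_nonneg_left (Real.log_le_log (div_pos (h0.trans_le h1) h0) ?_) zero_le_two
  gcongr
  exact ENNReal.toReal_le_of_le_ofReal
    (mul_nonneg zero_le_two ((abs_nonneg _).trans (ha 0 0))) (spectralRadius_map_le _ ha)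

theorem GL0.exists_eq_smul_one {g : GL0} (hg : g ∈ Subgroup.center GL0) :
    ∃ c : ℝ, g.1.1 = c • 1 := by
  rw [Subgroup.mem_center_iff] at hg
  have hu : ∀ u : SL(2, ℝ), Commute g.1.1 u.1 := fun u => by
    have := congrArg (fun k : GL0 => k.1.1) (hg (u : GL0))
    exact this.symm
  have h1 := hu ⟨!![1, 1; 0, 1], by simp [Matrix.det_fin_two]⟩
  have h2 := hu ⟨!![1, 0; 1, 1], by simp [Matrix.det_fin_two]⟩
  rw [Matrix.commute_fin_two_iff] at h1 h2
  simp at h1 h2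
  rw [Matrix.exists_eq_smul_one_iff]
  refine ⟨?_, ?_, ?_⟩ <;> grind

/-- A homothety has length zero, so finiteness of `‖L‖` forces its determinant `c ^ 2` to be `1`. -/
theorem map_center_pow_two (hρ : IsHyperbolicRep ρ) (hstable : dualStableNorm ρ ≠ ⊤) {γ : G}
    (hγ : γ ∈ Subgroup.center G) : ρ γ ^ 2 = 1 := by
  have hc : ρ γ ∈ Subgroup.center GL0 := by
    rw [← hρ.ker_eq, MonoidHom.mem_ker] at hγ
    exact (QuotientGroup.eq_one_iff _).1 hγ
  obtain ⟨c, hc⟩ := GL0.exists_eq_smul_one hc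
  have hdet : (ρ γ).1.1.det = c ^ 2 := by rw [hc]; simp
  have hdp := (ρ γ).det_pos
  have hr : (spectralRadius ℂ ((ρ γ).1.1.map (algebraMap ℝ ℂ))).toReal = |c| := by
    have : (ρ γ).1.1.map (algebraMap ℝ ℂ) = algebraMap ℂ _ (c : ℂ) := by
      rw [hc]
      ext i j
      fin_cases i <;> fin_cases j <;> simp [Matrix.algebraMap_matrix_apply]
    rw [spectralRadius, this, spectrum.scalar_eq]
    simp
  have ht : geodesicLength ρ γ = 0 := by
    rw [geodesicLength, hr, hdet, Real.sqrt_sq_eq_abs, div_self, Real.log_one, mul_zero]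
    intro h
    rw [abs_eq_zero] at h
    rw [hdet, h] at hdp
    norm_num at hdp
  have hL := abs_logFactor_le hstable γ
  rw [ht, mul_zero, abs_nonpos_iff, logFactor] at hL
  have h1 : √(ρ γ).1.1.det = 1 := Real.eq_one_of_pos_of_log_eq_zero (Real.sqrt_pos.2 hdp) hL
  rw [Real.sqrt_eq_one, hdet] at h1
  apply Subtype.ext
  apply Units.ext
  change (ρ γ).1.1 ^ 2 = 1
  rw [hc, smul_pow, h1, one_pow, one_smul]

theorem IsHyperbolicRep.isSaddle (hρ : IsHyperbolicRep ρ) {γ : G}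
    (hγ : ∀ n : ℕ, 0 < n → γ ^ n ∉ Subgroup.center G) : (ρ γ).1.1.IsSaddle := by
  obtain ⟨a, b, ha, hb, h1, h2⟩ := hρ.saddle γ hγ
  rw [Module.End.hasEigenvalue_iff_isRoot_charpoly, Matrix.charpoly_toLin', Polynomial.IsRoot,
    Matrix.charpoly_fin_two] at h1 h2
  simp at h1 h2
  have hab : a - b ≠ 0 := fun h => by
    rw [sub_eq_zero.1 h] at ha
    exact ha.not_gt hb
  have ht : (ρ γ).1.1.trace = a + b := by
    apply mul_left_cancel₀ hab
    linear_combination h2 - h1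
  refine ⟨a, b, ha, hb, ht, ?_⟩
  rw [ht] at h1
  linear_combination h1

end Hyperbolic

/-! ### Discreteness of hyperbolic representations -/

section Discrete

theorem GL0.mem_center {g : GL0} {c : ℝ} (hg : g.1.1 = c • 1) : g ∈ Subgroup.center GL0 := by
  refine Subgroup.mem_center_iff.2 fun k => Subtype.ext (Units.ext ?_)
  change k.1.1 * g.1.1 = g.1.1 * k.1.1
  rw [hg]
  simp

variable {Γ : Subgroup SLTilde} [DiscreteTopology Γ] [CompactSpace (SLTilde ⧸ Γ)] {ρ : Γ →* GL0}

/-- If a power of `γ` is central, `proj γ` has finite order, hence order dividing a uniform `N`.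
Then `γ ^ N` is central and its image squares to `1`. -/
theorem exists_pow_eq_one_or_isSaddle (hρ : IsHyperbolicRep ρ) (hstable : dualStableNorm ρ ≠ ⊤) :
    ∃ M > 0, ∀ γ, ρ γ ^ M = 1 ∨ (ρ γ).1.1.IsSaddle := by
  obtain ⟨N, hN, h⟩ := SLTilde.exists_forall_isOfFinOrder (Γ := Γ)
  refine ⟨N * 2, by positivity, fun γ => ?_⟩
  by_cases hγ : ∀ n : ℕ, 0 < n → γ ^ n ∉ Subgroup.center Γ
  · exact Or.inr (hρ.isSaddle hγ)
  · left
    push Not at hγ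
    obtain ⟨n, hn, hγn⟩ := hγ
    rw [SLTilde.mem_center_iff, Subgroup.coe_pow, map_pow] at hγn
    have hord : IsOfFinOrder (SLTilde.proj γ) := by
      rw [isOfFinOrder_iff_pow_eq_one]
      refine ⟨n * 2, by positivity, ?_⟩
      rw [pow_mul]
      rcases hγn with e | e <;> rw [e] <;> simp
    rw [pow_mul, ← map_pow]
    refine map_center_pow_two hρ hstable ((SLTilde.mem_center_iff _).2 (Or.inl ?_))
    rw [Subgroup.coe_pow, map_pow]
    exact h γ γ.2 hord

open scoped Topology in
-- In the nondiscrete case, for a saddle `ρ α` every conjugate of `α` equals `α` or `α⁻¹` modulo the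
-- kernel of `projLinearPart ρ`, which is the center. So `proj α` has only conjugates `±α^{±1}`
-- under `Γ`, a bounded set.
theorem exists_nhds_eq_one (hρ : IsHyperbolicRep ρ) (hstable : dualStableNorm ρ ≠ ⊤) :
    ∃ V ∈ 𝓝 (1 : GL (Fin 2) ℝ), ∀ γ, (ρ γ).1 ∈ V → (ρ γ).1 = 1 := by
  by_contra! hnd
  obtain ⟨M, hM, hMρ⟩ := exists_pow_eq_one_or_isSaddle hρ hstable
  let P : Subgroup (GL (Fin 2) ℝ) := ρ.range.map (Subgroup.subtype _)
  have hmem : ∀ γ, (ρ γ).1 ∈ P := fun γ => ⟨ρ γ, ⟨γ, rfl⟩, rfl⟩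
  have hP : ∀ g ∈ P, g ^ M = 1 ∨ g.1.IsSaddle := by
    rintro _ ⟨_, ⟨γ, rfl⟩, rfl⟩
    exact (hMρ γ).imp_left fun h => congrArg Subtype.val h
  have hdet : ∀ g ∈ P, 0 < g.1.det := by
    rintro _ ⟨g, -, rfl⟩
    exact GL0.det_pos g
  have hndP : ∀ V ∈ 𝓝 (1 : GL (Fin 2) ℝ), ∃ g ∈ P, g ∈ V ∧ g ≠ 1 := fun V hV => by
    obtain ⟨γ, h1, h2⟩ := hnd V hV
    exact ⟨_, hmem γ, h1, h2⟩
  obtain ⟨α, h1, h2⟩ := hnd _ (Matrix.GeneralLinearGroup.eventually_isSaddle hM hP hdet)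
  have hα : (ρ α).1.1.IsSaddle := h1 (hmem α) h2
  have hker : ∀ δ : Γ, (∃ c : ℝ, (ρ δ).1.1 = c • 1) → SLTilde.proj δ = 1 ∨ SLTilde.proj δ = -1 := by
    rintro δ ⟨c, hc⟩
    rw [← SLTilde.mem_center_iff, ← hρ.ker_eq, MonoidHom.mem_ker]
    exact (QuotientGroup.eq_one_iff _).2 (GL0.mem_center hc)
  have hnsc : ¬ ∃ c : ℝ, (SLTilde.proj α).1 = c • 1 := by
    intro h
    have hc := (SLTilde.mem_center_iff α).2
      (Matrix.SpecialLinearGroup.eq_one_or_eq_neg_one h)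
    rw [← hρ.ker_eq, MonoidHom.mem_ker] at hc
    exact Matrix.ne_smul_one_of_disc hα.disc_pos.ne'
      (GL0.exists_eq_smul_one ((QuotientGroup.eq_one_iff _).1 hc))
  set C := ∑ i, ∑ j, |(SLTilde.proj α).1 i j| with hC
  have hαC : ∀ i j, |(SLTilde.proj α).1 i j| ≤ C := (SLTilde.proj α).1.abs_apply_le_sum
  obtain ⟨γ, hγ, i, j, hij⟩ := SLTilde.exists_lt_abs_conj (Γ := Γ) hnsc C
  refine hij.not_ge ?_
  rw [← Matrix.SpecialLinearGroup.coe_mul, ← Matrix.SpecialLinearGroup.coe_mul]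
  have key : ∀ u : SL(2, ℝ), (∀ i j, |u.1 i j| ≤ C) →
      (SLTilde.proj γ * SLTilde.proj α * (SLTilde.proj γ)⁻¹ * u⁻¹ = 1 ∨
        SLTilde.proj γ * SLTilde.proj α * (SLTilde.proj γ)⁻¹ * u⁻¹ = -1) →
      |(SLTilde.proj γ * SLTilde.proj α * (SLTilde.proj γ)⁻¹).1 i j| ≤ C := by
    rintro u hu (h | h)
    · rw [mul_inv_eq_one.1 h]; exact hu i j
    · rw [mul_inv_eq_iff_eq_mul.1 h, neg_one_mul, Matrix.SpecialLinearGroup.coe_neg,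
        Matrix.neg_apply, abs_neg]
      exact hu i j
  rcases Matrix.GeneralLinearGroup.conj_eq_or_eq_of_not_discrete hM hP hdet hndP (hmem α) hα
    (hmem ⟨γ, hγ⟩) with e | e
  · refine key _ hαC ?_
    have := hker (⟨γ, hγ⟩ * α * ⟨γ, hγ⟩⁻¹ * α⁻¹) ⟨1, by
      rw [one_smul]
      simp only [map_mul, map_inv]
      change ((ρ ⟨γ, hγ⟩).1 * (ρ α).1 * (ρ ⟨γ, hγ⟩).1⁻¹).1 * ((ρ α).1⁻¹).1 = 1
      rw [e, ← Units.val_mul, mul_inv_cancel, Units.val_one]⟩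
    simpa using this
  · refine key _ (Matrix.SpecialLinearGroup.abs_inv_apply_le hαC) ?_
    have := hker (⟨γ, hγ⟩ * α * ⟨γ, hγ⟩⁻¹ * α) ⟨(ρ α).1.1.det, by
      simp only [map_mul, map_inv]
      change ((ρ ⟨γ, hγ⟩).1 * (ρ α).1 * (ρ ⟨γ, hγ⟩).1⁻¹).1 * (ρ α).1.1 = _
      rw [e, smul_mul_assoc, ← Units.val_mul, inv_mul_cancel, Units.val_one]⟩
    simpa using this

end Discrete

/-! ### Compact sets of flags -/

/-- The points of the affine plane with coordinates less than `R` in absolute value. -/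
def RP2.box (R : ℝ) : Set RP2 :=
  {p | |p.rep 0| < R * |p.rep 2| ∧ |p.rep 1| < R * |p.rep 2|}

theorem RP2.mk_mem_box {R : ℝ} {v : Fin 3 → ℝ} (hv : v ≠ 0) :
    Projectivization.mk ℝ v hv ∈ RP2.box R ↔ |v 0| < R * |v 2| ∧ |v 1| < R * |v 2| := by
  obtain ⟨a, ha⟩ := Projectivization.exists_smul_eq_mk_rep ℝ v hv
  have ha0 : 0 < |(a : ℝ)| := abs_pos.2 a.ne_zero
  change |(Projectivization.mk ℝ v hv).rep 0| < _ ∧ _ ↔ _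
  rw [← ha]
  simp only [Units.smul_def, Pi.smul_apply, smul_eq_mul, abs_mul]
  rw [mul_left_comm, mul_lt_mul_iff_right₀ ha0, mul_lt_mul_iff_right₀ ha0]

theorem RP2.isOpen_box (R : ℝ) : IsOpen (RP2.box R) := by
  rw [isOpen_coinduced]
  have h : ∀ i, Continuous fun v : {v : Fin 3 → ℝ // v ≠ 0} => |v.1 i| := fun i =>
    ((continuous_apply i).comp continuous_subtype_val).abs
  have : Projectivization.mk' ℝ ⁻¹' RP2.box R = {v : {v : Fin 3 → ℝ // v ≠ 0} |
      |v.1 0| < R * |v.1 2|} ∩ {v | |v.1 1| < R * |v.1 2|} := by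
    ext v
    exact RP2.mk_mem_box v.2
  rw [this]
  exact (isOpen_lt (h 0) (continuous_const.mul (h 2))).inter
    (isOpen_lt (h 1) (continuous_const.mul (h 2)))

theorem RP2.box_mono {R S : ℝ} (h : R ≤ S) : RP2.box R ⊆ RP2.box S := fun _ hp =>
  ⟨hp.1.trans_le (mul_le_mul_of_nonneg_right h (abs_nonneg _)),
    hp.2.trans_le (mul_le_mul_of_nonneg_right h (abs_nonneg _))⟩

theorem RP2.exists_mem_box {v : Fin 3 → ℝ} (hv : v ≠ 0) (h2 : v 2 ≠ 0) :
    ∃ n : ℕ, Projectivization.mk ℝ v hv ∈ RP2.box n := by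
  obtain ⟨n, hn⟩ := exists_nat_gt (max (|v 0| / |v 2|) (|v 1| / |v 2|))
  have hp := abs_pos.2 h2
  refine ⟨n, (RP2.mk_mem_box hv).2 ⟨?_, ?_⟩⟩
  · exact (div_lt_iff₀ hp).1 ((le_max_left _ _).trans_lt hn)
  · exact (div_lt_iff₀ hp).1 ((le_max_right _ _).trans_lt hn)

/-- Homogeneous coordinates of a flag in `X₀`. -/
theorem X0.exists_coordinates (f : X0) : ∃ (v w : Fin 3 → ℝ) (hv : v ≠ 0) (hw : w ≠ 0),
    f.1.1 = Projectivization.mk ℝ v hv ∧ f.1.2 = Projectivization.mk ℝ w hw ∧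
      v 0 * w 0 + v 1 * w 1 + v 2 * w 2 = 0 ∧ v 2 ≠ 0 ∧ w 2 ≠ 0 ∧ (v 0 ≠ 0 ∨ v 1 ≠ 0) := by
  obtain ⟨⟨p, q⟩, h1, ⟨h2, h3⟩, h4⟩ := f
  induction p using Projectivization.ind with | h v hv =>
  induction q using Projectivization.ind with | h w hw =>
  refine ⟨v, w, hv, hw, rfl, rfl, ?_, ?_, ?_, ?_⟩
  · have := (Projectivization.orthogonal_mk hv hw).1 h1
    simpa [dotProduct, Fin.sum_univ_three] using this
  · intro h
    refine h2 ((Projectivization.orthogonal_mk hv _).2 ?_)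
    simp [dotProduct, Fin.sum_univ_three, h]
  · intro h
    refine h4 ((Projectivization.orthogonal_mk _ hw).2 ?_)
    simp [dotProduct, Fin.sum_univ_three, h]
  · by_contra! h
    refine h3 ((Projectivization.mk_eq_mk_iff' ℝ _ _ _ _).2 ⟨v 2, ?_⟩)
    ext i
    fin_cases i <;> simp [h]

/-- The same affine chart serves points and lines: a point off the line at infinity and a line off
the origin both have nonzero third coordinate. -/
theorem X0.exists_forall_mem_box {K : Set X0} (hK : IsCompact K) :
    ∃ n : ℕ, ∀ f ∈ K, f.1.1 ∈ RP2.box n ∧ f.1.2 ∈ RP2.box n := by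
  have h : ∀ F : X0 → RP2, Continuous F → (∀ f, ∃ n : ℕ, F f ∈ RP2.box n) →
      ∃ n : ℕ, ∀ f ∈ K, F f ∈ RP2.box n := by
    intro F hF hb
    obtain ⟨n, hn⟩ := hK.elim_directed_cover (fun n : ℕ => F ⁻¹' RP2.box n)
      (fun n => (RP2.isOpen_box n).preimage hF)
      (fun f _ => Set.mem_iUnion.2 (hb f))
      (directed_of_isDirected_le fun m n hmn =>
        Set.preimage_mono (RP2.box_mono (by exact_mod_cast hmn)))
    exact ⟨n, hn⟩
  obtain ⟨m, hm⟩ := h (fun f => f.1.1) (continuous_fst.comp continuous_subtype_val) fun f => by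
    obtain ⟨v, w, hv, hw, e1, e2, -, h1, h2, -⟩ := X0.exists_coordinates f
    rw [e1]
    exact RP2.exists_mem_box hv h1
  obtain ⟨n, hn⟩ := h (fun f => f.1.2) (continuous_snd.comp continuous_subtype_val) fun f => by
    obtain ⟨v, w, hv, hw, e1, e2, -, h1, h2, -⟩ := X0.exists_coordinates f
    rw [e2]
    exact RP2.exists_mem_box hw h2
  refine ⟨max m n, fun f hf => ⟨RP2.box_mono ?_ (hm f hf), RP2.box_mono ?_ (hn f hf)⟩⟩
  · exact_mod_cast le_max_left m n
  · exact_mod_cast le_max_right m n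

theorem GL0.smul_fst (g : GL0) (f : X0) {v : Fin 3 → ℝ} (hv : v ≠ 0)
    (h : f.1.1 = Projectivization.mk ℝ v hv) :
    ∃ hv', (g • f).1.1 = Projectivization.mk ℝ ![g.1.1 0 0 * v 0 + g.1.1 0 1 * v 1,
      g.1.1 1 0 * v 0 + g.1.1 1 1 * v 1, v 2] hv' := by
  have e : (toGL3 g) • v = ![g.1.1 0 0 * v 0 + g.1.1 0 1 * v 1,
      g.1.1 1 0 * v 0 + g.1.1 1 1 * v 1, v 2] := by
    change blockHom g.1.1 *ᵥ v = _
    ext i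
    fin_cases i <;> simp [blockHom, Matrix.mulVec, dotProduct, Fin.sum_univ_three]
  refine ⟨e ▸ (smul_ne_zero_iff_ne _).2 hv, ?_⟩
  change toGL3 g • f.1.1 = _
  rw [h, Projectivization.smul_mk]
  congr 1

theorem GL0.smul_snd (g : GL0) (f : X0) {w : Fin 3 → ℝ} (hw : w ≠ 0)
    (h : f.1.2 = Projectivization.mk ℝ w hw) :
    ∃ hw', (g • f).1.2 = Projectivization.mk ℝ ![g.1⁻¹.1 0 0 * w 0 + g.1⁻¹.1 1 0 * w 1,
      g.1⁻¹.1 0 1 * w 0 + g.1⁻¹.1 1 1 * w 1, w 2] hw' := by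
  have e : theta (toGL3 g) • w = ![g.1⁻¹.1 0 0 * w 0 + g.1⁻¹.1 1 0 * w 1,
      g.1⁻¹.1 0 1 * w 0 + g.1⁻¹.1 1 1 * w 1, w 2] := by
    change (blockHom (g.1⁻¹).1)ᵀ *ᵥ w = _
    ext i
    fin_cases i <;> simp [blockHom, Matrix.mulVec, dotProduct, Fin.sum_univ_three]
  refine ⟨e ▸ (smul_ne_zero_iff_ne _).2 hw, ?_⟩
  change theta (toGL3 g) • f.1.2 = _
  rw [h, Projectivization.smul_mk]
  congr 1

/-- The group of units is closed in pairs (matrix, inverse), so both need a bound. -/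
theorem Matrix.GeneralLinearGroup.isCompact_setOf_abs_apply_le (C : ℝ) :
    IsCompact {g : GL (Fin 2) ℝ | (∀ i j, |g.1 i j| ≤ C) ∧ ∀ i j, |g⁻¹.1 i j| ≤ C} := by
  have h := Matrix.isCompact_setOf_abs_apply_le C
  exact (congrArg IsCompact (Set.ext fun _ => Iff.rfl)).mp
    (Units.isClosedEmbedding_embedProduct.isCompact_preimage
      (h.prod (MulOpposite.opHomeomorph.symm.isCompact_preimage.2 h)))

/-- A matrix that maps a bounded vector and a bounded covector, paired to `1`, to bounded ones has
its entries bounded in terms of its determinant. -/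
theorem abs_apply_le_of_pairing {A : Matrix (Fin 2) (Fin 2) ℝ} (hA : 0 < A.det)
    {R x₀ x₁ m₀ m₁ : ℝ} (hx₀ : |x₀| ≤ R) (hx₁ : |x₁| ≤ R) (hm₀ : |m₀| ≤ R) (hm₁ : |m₁| ≤ R)
    (hy₀ : |A 0 0 * x₀ + A 0 1 * x₁| ≤ R) (hy₁ : |A 1 0 * x₀ + A 1 1 * x₁| ≤ R)
    (hl₀ : |m₀ * A 0 0 + m₁ * A 1 0| ≤ R) (hl₁ : |m₀ * A 0 1 + m₁ * A 1 1| ≤ R)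
    (h1 : m₀ * (A 0 0 * x₀ + A 0 1 * x₁) + m₁ * (A 1 0 * x₀ + A 1 1 * x₁) = 1) (i j : Fin 2) :
    |A i j| ≤ R ^ 2 * (1 + A.det) := by
  -- With `y = A x`, `l = m A` and `m A x = 1`, the matrix `A` is `y l` plus `det A` times the
  -- product of `m` and `x`, each turned by a right angle.
  have key : ∀ {a l y d m x : ℝ}, a = l * y + d * (m * x) → |d| = A.det → |l| ≤ R → |y| ≤ R →
      |m| ≤ R → |x| ≤ R → |a| ≤ R ^ 2 * (1 + A.det) := by
    intro a l y d m x ha hd hl hy hm hx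
    have hR : 0 ≤ R := (abs_nonneg _).trans hl
    rw [ha]
    refine (abs_add_le _ _).trans ?_
    rw [abs_mul, abs_mul, abs_mul, hd]
    have h1 := mul_le_mul hl hy (abs_nonneg _) hR
    have h2 := mul_le_mul_of_nonneg_left (mul_le_mul hm hx (abs_nonneg _) hR) hA.le
    linarith
  have hdet := Matrix.det_fin_two A
  have hp := abs_of_pos hA
  have hn : |-A.det| = A.det := by rw [abs_neg, hp]
  fin_cases i <;> fin_cases j
  · refine key (?_ : A 0 0 = _) hp hl₀ hy₀ hm₁ hx₁
    rw [hdet]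
    linear_combination -A 0 0 * h1
  · refine key (?_ : A 0 1 = _) hn hl₁ hy₀ hm₁ hx₀
    rw [hdet]
    linear_combination -A 0 1 * h1
  · refine key (?_ : A 1 0 = _) hn hl₀ hy₁ hm₀ hx₁
    rw [hdet]
    linear_combination -A 1 0 * h1
  · refine key (?_ : A 1 1 = _) hp hl₁ hy₁ hm₀ hx₀
    rw [hdet]
    linear_combination -A 1 1 * h1

theorem GL0.abs_apply_le_of_mem_box {g : GL0} {f : X0} {R : ℝ} (h1 : f.1.1 ∈ RP2.box R)
    (h2 : (g • f).1.1 ∈ RP2.box R) (h3 : f.1.2 ∈ RP2.box R) (h4 : (g • f).1.2 ∈ RP2.box R)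
    (i j : Fin 2) : |g.1.1 i j| ≤ R ^ 2 * (1 + g.1.1.det) := by
  obtain ⟨v, w, hv, hw, e1, e2, hvw, hv2, hw2, -⟩ := X0.exists_coordinates f
  obtain ⟨hv', e3⟩ := g.smul_fst f hv e1
  obtain ⟨hw', e4⟩ := g.smul_snd f hw e2
  rw [e1, RP2.mk_mem_box] at h1
  rw [e2, RP2.mk_mem_box] at h3
  rw [e3, RP2.mk_mem_box] at h2
  rw [e4, RP2.mk_mem_box] at h4
  simp only [Matrix.cons_val_zero, Matrix.cons_val_one, Matrix.cons_val] at h2 h4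
  have hB : g.1⁻¹.1 * g.1.1 = 1 := by rw [← Units.val_mul, inv_mul_cancel, Units.val_one]
  set A := g.1.1 with hA
  set B := g.1⁻¹.1
  rw [← Matrix.ext_iff] at hB
  simp only [Fin.forall_fin_two, Matrix.mul_apply, Fin.sum_univ_two] at hB
  obtain ⟨⟨b1, b2⟩, b3, b4⟩ := hB
  simp at b1 b2 b3 b4
  have hdiv : ∀ {s t : ℝ}, t ≠ 0 → |s| < R * |t| → |s / t| ≤ R := fun {s t} ht h => by
    rw [abs_div, div_le_iff₀ (abs_pos.2 ht)]
    exact h.le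
  have hneg : ∀ {s t : ℝ}, t ≠ 0 → |s| < R * |t| → |-(s / t)| ≤ R := fun {s t} ht h => by
    rw [abs_neg]
    exact hdiv ht h
  -- `x` is the point of `f`, and the line of `g • f` is `{p | m p = 1}`; pulling `m` back by `g`
  -- gives the line of `f`.
  refine abs_apply_le_of_pairing g.det_pos (x₀ := v 0 / v 2) (x₁ := v 1 / v 2)
    (m₀ := -((B 0 0 * w 0 + B 1 0 * w 1) / w 2)) (m₁ := -((B 0 1 * w 0 + B 1 1 * w 1) / w 2))
    (hdiv hv2 h1.1) (hdiv hv2 h1.2) (hneg hw2 h4.1) (hneg hw2 h4.2) ?_ ?_ ?_ ?_ ?_ i j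
  · convert hdiv hv2 h2.1 using 2; ring
  · convert hdiv hv2 h2.2 using 2; ring
  · convert hneg hw2 h3.1 using 2
    field_simp
    linear_combination -w 0 * b1 - w 1 * b3
  · convert hneg hw2 h3.2 using 2
    field_simp
    linear_combination -w 0 * b2 - w 1 * b4
  · field_simp
    linear_combination -hvw - w 0 * v 0 * b1 - w 1 * v 0 * b3 - w 0 * v 1 * b2 - w 1 * v 1 * b4

/-- As `δ + δ⁻¹ ≤ 2 exp |log δ|`, the hypothesis gives `|log δ| ≤ 2 c (log (4 R) + |log δ|)`, which
can be solved for `|log δ|` because `2 c < 1`. This is where the bound `1/2` on the stable norm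
enters. -/
theorem bound_of_abs_log_le {c R : ℝ} (hc0 : 0 ≤ c) (hc : c < 1 / 2) (hR : 1 ≤ R) {δ : ℝ}
    (hδ : 0 < δ) (h : |Real.log δ| ≤ c * (2 * Real.log (2 * (R * (1 + δ ^ 2)) / δ))) :
    |Real.log δ| ≤ 2 * c * Real.log (4 * R) / (1 - 2 * c) := by
  have h1 : Real.log (2 * (R * (1 + δ ^ 2)) / δ) ≤ Real.log (4 * R) + |Real.log δ| := by
    rw [← Real.log_exp |Real.log δ|, ← Real.log_mul (by positivity) (Real.exp_pos _).ne']
    refine Real.log_le_log (by positivity) ?_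
    have e1 : δ ≤ Real.exp |Real.log δ| := by
      conv_lhs => rw [← Real.exp_log hδ]
      exact Real.exp_le_exp.2 (le_abs_self _)
    have e2 : δ⁻¹ ≤ Real.exp |Real.log δ| := by
      rw [← Real.exp_log (inv_pos.2 hδ), Real.log_inv]
      exact Real.exp_le_exp.2 (neg_le_abs _)
    have : 2 * (R * (1 + δ ^ 2)) / δ = 2 * R * (δ⁻¹ + δ) := by field_simp
    rw [this]
    nlinarith
  rw [le_div_iff₀ (by linarith)]
  nlinarith [mul_le_mul_of_nonneg_left h1 hc0]

/-! ### The action on flags -/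

theorem Matrix.GeneralLinearGroup.abs_inv_apply_le {g : GL (Fin 2) ℝ} {C D : ℝ}
    (hg : ∀ i j, |g.1 i j| ≤ C) (hD : |g.1.det|⁻¹ ≤ D) (i j : Fin 2) : |g⁻¹.1 i j| ≤ D * C := by
  have hadj : |g.1.adjugate i j| ≤ C := by
    rw [Matrix.adjugate_fin_two]
    fin_cases i <;> fin_cases j <;> simp [hg]
  rw [val_inv_eq, Matrix.smul_apply, smul_eq_mul, abs_mul, abs_inv]
  exact mul_le_mul hD hadj (abs_nonneg _) ((inv_nonneg.2 (abs_nonneg _)).trans hD)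

/-- The point of the flag is a nonzero fixed vector in `ℝ²`, so the characteristic polynomial
vanishes at `1`. -/
theorem GL0.det_sub_trace_of_smul_eq {g : GL0} {f : X0} (h : g • f = f) :
    1 - g.1.1.trace + g.1.1.det = 0 := by
  obtain ⟨v, w, hv, hw, e1, -, -, hv2, -, hv01⟩ := X0.exists_coordinates f
  obtain ⟨hv', e3⟩ := g.smul_fst f hv e1
  rw [h, e1, Projectivization.mk_eq_mk_iff'] at e3
  obtain ⟨a, ha⟩ := e3
  have h0 := congrFun ha 0
  have h1 := congrFun ha 1
  have h2 := congrFun ha 2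
  simp at h0 h1 h2
  have ha1 : a = 1 := mul_right_cancel₀ hv2 (by rw [h2, one_mul])
  rw [ha1, one_mul] at h0 h1
  rw [Matrix.trace_fin_two, Matrix.det_fin_two]
  rcases hv01 with h | h
  · apply mul_left_cancel₀ h
    linear_combination (g.1.1 1 1 - 1) * h0 - g.1.1 0 1 * h1
  · apply mul_left_cancel₀ h
    linear_combination (g.1.1 0 0 - 1) * h1 - g.1.1 1 0 * h0

theorem exists_abs_apply_le {G : Type*} [Group G] {ρ : G →* GL0}
    (hstable : dualStableNorm ρ < 1 / 2) (R : ℝ) :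
    ∃ C : ℝ, ∀ γ, (∀ i j, |(ρ γ).1.1 i j| ≤ R ^ 2 * (1 + (ρ γ).1.1.det)) →
      (∀ i j, |(ρ γ).1.1 i j| ≤ C) ∧ ∀ i j, |(ρ γ).1⁻¹.1 i j| ≤ C := by
  have htop : dualStableNorm ρ ≠ ⊤ := (hstable.trans_le le_top).ne
  set c := (dualStableNorm ρ).toReal with hc
  have hc0 : 0 ≤ c := ENNReal.toReal_nonneg
  have hc1 : c < 1 / 2 := by
    have := (ENNReal.toReal_lt_toReal htop (by simp)).2 hstable
    simpa using this
  set S := max 1 (R ^ 2) with hS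
  set K := 2 * c * Real.log (4 * S) / (1 - 2 * c) with hK
  set C := S * (1 + Real.exp K ^ 2) with hC
  -- `K` bounds `|log δ|`, so `exp K ^ 2` bounds both the determinant `δ ^ 2` and its inverse; the
  -- latter controls `A⁻¹` through the adjugate.
  refine ⟨max C (Real.exp K ^ 2 * C), fun γ hγ => ?_⟩
  have hdet := (ρ γ).det_pos
  set δ := √(ρ γ).1.1.det with hδ
  have hδ0 : 0 < δ := Real.sqrt_pos.2 hdet
  have hδ2 : (ρ γ).1.1.det = δ ^ 2 := (Real.sq_sqrt hdet.le).symm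
  have hγS : ∀ i j, |(ρ γ).1.1 i j| ≤ S * (1 + δ ^ 2) := fun i j => by
    refine (hγ i j).trans ?_
    rw [hδ2]
    exact mul_le_mul_of_nonneg_right (le_max_right _ _) (by positivity)
  have hlog : |Real.log δ| ≤ K := bound_of_abs_log_le hc0 hc1 (le_max_left _ _) hδ0
    ((abs_logFactor_le htop γ).trans (mul_le_mul_of_nonneg_left (geodesicLength_le hγS) hc0))
  obtain ⟨hl1, hl2⟩ := abs_le.1 hlog
  have hδK : δ ≤ Real.exp K := by
    rw [← Real.exp_log hδ0]
    exact Real.exp_le_exp.2 hl2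
  have hδK' : δ⁻¹ ≤ Real.exp K := by
    rw [← Real.exp_log (inv_pos.2 hδ0), Real.log_inv]
    exact Real.exp_le_exp.2 (by linarith)
  have hle : ∀ i j, |(ρ γ).1.1 i j| ≤ C := fun i j => by
    refine (hγS i j).trans ?_
    rw [hC]
    gcongr
  refine ⟨fun i j => (hle i j).trans (le_max_left _ _), fun i j =>
    (Matrix.GeneralLinearGroup.abs_inv_apply_le hle ?_ i j).trans (le_max_right _ _)⟩
  rw [abs_of_pos hdet, hδ2, ← inv_pow]
  gcongr

section Main

variable {Γ : Subgroup SLTilde} [DiscreteTopology Γ] [CompactSpace (SLTilde ⧸ Γ)] {ρ : Γ →* GL0}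

theorem eq_one_of_smul_eq (hρ : IsHyperbolicRep ρ) (hstable : dualStableNorm ρ ≠ ⊤) (γ : Γ)
    {f : X0} (hf : ρ γ • f = f) : ρ γ = 1 := by
  have h := GL0.det_sub_trace_of_smul_eq hf
  obtain ⟨M, hM, hMρ⟩ := exists_pow_eq_one_or_isSaddle hρ hstable
  rcases hMρ γ with hγ | ⟨a, b, ha, hb, ht, hd⟩
  · have hγ' : (ρ γ).1 ^ M = 1 := congrArg Subtype.val hγ
    have hdet := Matrix.GeneralLinearGroup.det_eq_one_of_pow_eq_one hM (ρ γ).det_pos hγ'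
    refine Subtype.ext (Units.ext (Matrix.eq_one_of_trace_eq_two hdet hM ?_ (by linarith)))
    rw [← Units.val_pow_eq_pow_val, hγ', Units.val_one]
  · exfalso
    rw [ht, hd] at h
    have h1 : (1 - a) * (1 - b) = 0 := by linear_combination h
    rcases mul_eq_zero.1 h1 with h1 | h1
    · rw [← sub_eq_zero.1 h1] at ha
      norm_num at ha
    · rw [← sub_eq_zero.1 h1] at hb
      norm_num at hb

theorem finite_setOf_abs_apply_le (hρ : IsHyperbolicRep ρ) (hstable : dualStableNorm ρ ≠ ⊤)
    (C : ℝ) :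
    {g : ρ.range | (∀ i j, |g.1.1.1 i j| ≤ C) ∧ ∀ i j, |g.1.1⁻¹.1 i j| ≤ C}.Finite := by
  obtain ⟨V, hV, hVρ⟩ := exists_nhds_eq_one hρ hstable
  have hfin := Subgroup.finite_inter_of_isCompact
    (H := ρ.range.map (Subgroup.subtype _)) hV (by
      rintro _ ⟨_, ⟨γ, rfl⟩, rfl⟩ h
      exact hVρ γ h) (Matrix.GeneralLinearGroup.isCompact_setOf_abs_apply_le C)
  have hinj : Function.Injective fun g : ρ.range => g.1.1 :=
    Subtype.val_injective.comp Subtype.val_injective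
  refine (hfin.preimage (hinj.injOn (s := _))).subset fun g hg => ?_
  exact ⟨⟨g.1, g.2, rfl⟩, hg⟩

end Main

theorem mainTheorem10 (Γ : Subgroup SLTilde) [DiscreteTopology Γ] [CompactSpace (SLTilde ⧸ Γ)]
    (ρ : Γ →* GL0) (hρ : IsHyperbolicRep ρ) (hstable : dualStableNorm ρ < 1 / 2) :
    (∀ g ∈ ρ.range, ∀ f : X0, g • f = f → g = 1) ∧ ProperlyDiscontinuousSMul ρ.range X0 := by
  have htop : dualStableNorm ρ ≠ ⊤ := (hstable.trans_le le_top).ne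
  refine ⟨?_, ⟨fun {K L} hK hL => ?_⟩⟩
  · rintro _ ⟨γ, rfl⟩ f hf
    exact eq_one_of_smul_eq hρ htop γ hf
  · obtain ⟨m, hm⟩ := X0.exists_forall_mem_box hK
    obtain ⟨n, hn⟩ := X0.exists_forall_mem_box hL
    have hmR : (m : ℝ) ≤ max (m : ℝ) n := le_max_left _ _
    have hnR : (n : ℝ) ≤ max (m : ℝ) n := le_max_right _ _
    obtain ⟨C, hC⟩ := exists_abs_apply_le hstable (max (m : ℝ) n)
    refine (finite_setOf_abs_apply_le hρ htop C).subset ?_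
    rintro ⟨_, γ, rfl⟩ ⟨_, ⟨f, hf, rfl⟩, hfL⟩
    exact hC γ (GL0.abs_apply_le_of_mem_box (RP2.box_mono hmR (hm f hf).1)
      (RP2.box_mono hnR (hn _ hfL).1) (RP2.box_mono hmR (hm f hf).2)
      (RP2.box_mono hnR (hn _ hfL).2))
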